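/- \textbf{Conventions.} Let $K$ be a field and $V$ an $n$-dimensional $K$-vector space. A central arrangement $\mathcal A$ in $V$ is a finite set of linear hyperplanes $H=\ker\alpha_H$ of $V$. Let $L(\mathcal A)$ be the set of all intersections of members of $\mathcal A$ (including $V$, the empty intersection). For a subspace $X$, the restriction $\mathcal A^X=\{H\cap X : H\in\mathcal A,\ X\not\subseteq H\}$ is an arrangement in $X$. With $S=K[x_1,\dots,x_n]$ the polynomial ring in coordinates of $V$ and $Q=\prod_{H\in\mathcal A}\alpha_H$, put $D(\mathcal A)=\{\theta\in\mathrm{Der}_K(S) : \theta(Q)\in QS\}$. The arrangement $\mathcal A$ is free with exponents the multiset $\exp(\mathcal A)=(e_1,\dots,e_n)$ if $D(\mathcal A)$ has an $S$-basis $\theta_1,\dots,\theta_n$ with $\theta_i$ homogeneous of degree $e_i$ (that is, all $\theta_i(x_j)$ are homogeneous polynomials of degree $e_i$). The class of inductively free arrangements is the smallest class that contains all empty arrangements and contains $\mathcal A$ whenever there is $H\in\mathcal A$ such that $\mathcal A\setminus\{H\}$ and $\mathcal A^H$ are in the class and $\exp(\mathcal A^H)\subseteq\exp(\mathcal A\setminus\{H\})$.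 The arrangement $\mathcal A$, free with exponents $e_1\le\dots\le e_n$, is \emph{flag-accurate} if there is a flag $X_1\subseteq X_2\subseteq\dots\subseteq X_n=V$ of members of $L(\mathcal A)$ with $\dim X_i=i$ such that $\mathcal A^{X_i}$ is free with exponents $(e_1,\dots,e_i)$ for all $1\le i\le n$; such a flag is called a witness. It is \emph{ind-flag-accurate} if it is inductively free and flag-accurate and there is a witness such that moreover every $\mathcal A^{X_i}$ is inductively free. The cone $\mathbf c\mathcal A$ over an arrangement $\mathcal A$ of affine hyperplanes in $V$ is the central arrangement in $V\times K$, with $z$ the last coordinate, that consists of $z=0$ and of $\alpha=cz$ for every hyperplane $\alpha=c$ of $\mathcal A$ ($\alpha$ a non-zero linear form on $V$, $c\in K$). For integers $m,d\ge 0$, $1\le k\le\ell$ and $0\le p\le\ell$, the Shi descendant $\mathcal A^{p,k}_\ell(m,d)$ is the arrangement in $\mathbb R^\ell$ that consists of the hyperplanes \begin{align*} x_i-x_j&=0 && (1\le i<j\le\ell),\\ x_i-x_j&=1 && (1\le i<j\le\ell+1-k),\\ x_i&=c && (1\le i\le p,\ c\in\mathbb Z,\ 1-\min\{\ell-i+1,k\}-m\le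 c\le d),\\ x_i&=c && (p<i\le\ell,\ c\in\mathbb Z,\ -\min\{\ell-i+1,k\}-m\le c\le d). \end{align*} \textbf{Theorem.} Let $d,m\ge0$, $1\le k\le\ell$ and $0\le p\le\ell$ be integers. The cone over $\mathcal A^{p,k}_\ell(m,d)$ is ind-flag-accurate. It is free, and its (uniquely determined) multiset of exponents is $$\exp\bigl(\mathbf c\mathcal A^{p,k}_\ell(m,d)\bigr)=\bigl(1,(\ell+m+d)^{p},(\ell+m+d+1)^{\ell-p}\bigr),$$ where $e^{r}$ stands for $e$ repeated $r$ times. In particular, for fixed $\ell,m,d,p$ the exponents do not depend on $k$, i.e. they are constant along each row of the Shi descendant matrix $(\mathcal A^{p,k}_\ell(m,d))_{0\le p\le\ell,\,1\le k\le\ell}$. -/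

import Mathlib

noncomputable section

namespace HypArr

universe u

/-- A finite collection of affine hyperplanes `{x | α x = c}`, `α ≠ 0`, in a vector space `V`. -/
structure AffineArrangement (K : Type*) [Field K] (V : Type*) [AddCommGroup V] [Module K V] where
  hyperplanes : Set (Set V)
  finite : hyperplanes.Finite
  isHyperplane : ∀ H ∈ hyperplanes, ∃ (α : Module.Dual K V) (c : K), α ≠ 0 ∧ H = {x | α x = c}

/-- A finite collection of linear hyperplanes `ker α`, `α ≠ 0`, in a vector space `V`. -/
structure CentralArrangement (K : Type*) [Field K] (V : Type*) [AddCommGroup V] [Module K V] where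
  hyperplanes : Set (Submodule K V)
  finite : hyperplanes.Finite
  isHyperplane : ∀ H ∈ hyperplanes, ∃ α : Module.Dual K V, α ≠ 0 ∧ H = LinearMap.ker α

section Cone

variable {K : Type*} [Field K] {V : Type*} [AddCommGroup V] [Module K V]

/-- The linear form `(x, z) ↦ α x - c z` on `V × K`: the homogenization of `α - c`. -/
def homogenize (α : Module.Dual K V) (c : K) : Module.Dual K (V × K) :=
  α ∘ₗ LinearMap.fst K V K - c • LinearMap.snd K V K

theorem homogenize_apply (α : Module.Dual K V) (c : K) (v : V × K) :
    homogenize α c v = α v.1 - c * v.2 := by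
  simp [homogenize]

theorem homogenize_ne_zero {α : Module.Dual K V} (hα : α ≠ 0) (c : K) : homogenize α c ≠ 0 := by
  intro h
  apply hα
  ext x
  have := congrArg (fun f : Module.Dual K (V × K) => f (x, 0)) h
  simpa [homogenize_apply] using this

theorem ker_homogenize {α : Module.Dual K V} (hα : α ≠ 0) (c : K) :
    LinearMap.ker (homogenize α c) =
      Submodule.span K ((fun x : V => (x, (1 : K))) '' {x | α x = c}) := by
  apply le_antisymm
  · rintro ⟨x, z⟩ h
    rw [LinearMap.mem_ker, homogenize_apply, sub_eq_zero] at h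
    simp only at h
    by_cases hz : z = 0
    · subst hz
      obtain ⟨x₀, hx₀⟩ : ∃ x₀, α x₀ = c := LinearMap.surjective hα c
      have h1 : ((x₀ + x, 1) : V × K) ∈
          Submodule.span K ((fun x : V => (x, (1 : K))) '' {x | α x = c}) :=
        Submodule.subset_span ⟨x₀ + x, by simp [hx₀, h], rfl⟩
      have h2 : ((x₀, 1) : V × K) ∈
          Submodule.span K ((fun x : V => (x, (1 : K))) '' {x | α x = c}) :=
        Submodule.subset_span ⟨x₀, hx₀, rfl⟩
      simpa using Submodule.sub_mem _ h1 h2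
    · have h1 : ((z⁻¹ • x, 1) : V × K) ∈
          Submodule.span K ((fun x : V => (x, (1 : K))) '' {x | α x = c}) :=
        Submodule.subset_span ⟨z⁻¹ • x, by simp [h]; field_simp, rfl⟩
      simpa [smul_smul, hz] using Submodule.smul_mem _ z h1
  · rw [Submodule.span_le]
    rintro _ ⟨x, hx, rfl⟩
    have hx' : α x = c := hx
    simp [homogenize_apply, hx']

/-- The cone over an affine arrangement in `V`: the central arrangement in `V × K` consisting of
the hyperplane at infinity `z = 0` and of the homogenization `α = c z` of every hyperplane
`α = c`. -/
def AffineArrangement.cone (A : AffineArrangement K V) : CentralArrangement K (V × K) where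
  hyperplanes := {LinearMap.ker (LinearMap.snd K V K)} ∪
    {Y | ∃ (α : Module.Dual K V) (c : K), α ≠ 0 ∧ {x | α x = c} ∈ A.hyperplanes ∧
      Y = LinearMap.ker (homogenize α c)}
  finite := by
    refine (Set.finite_singleton _).union (Set.Finite.subset (A.finite.image
      (fun H => Submodule.span K ((fun x : V => (x, (1 : K))) '' H))) ?_)
    rintro _ ⟨α, c, hα, hH, rfl⟩
    exact ⟨_, hH, (ker_homogenize hα c).symm⟩
  isHyperplane := by
    rintro Y (rfl | ⟨α, c, hα, -, rfl⟩)
    · refine ⟨LinearMap.snd K V K, fun h => ?_, rfl⟩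
      have := congrArg (fun f : Module.Dual K (V × K) => f (0, 1)) h
      simp at this
    · exact ⟨_, homogenize_ne_zero hα c, rfl⟩

end Cone

section Poly

open MvPolynomial

variable {K : Type*} [Field K] {V : Type*} [AddCommGroup V] [Module K V] {n : ℕ}

/-- The linear form `α` as a polynomial in the coordinates with respect to the basis `b`. -/
def linPoly (b : Module.Basis (Fin n) K V) (α : Module.Dual K V) : MvPolynomial (Fin n) K :=
  ∑ i, C (α (b i)) * X i

open Classical in
/-- A linear form with kernel `H`, unique up to a non-zero scalar if `H` is a hyperplane
(and `0` if `H` is not a hyperplane). -/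
def definingForm (H : Submodule K V) : Module.Dual K V :=
  if h : ∃ α : Module.Dual K V, α ≠ 0 ∧ H = LinearMap.ker α then h.choose else 0

/-- The defining polynomial `Q(A) = ∏ α_H`. -/
def CentralArrangement.definingPoly (A : CentralArrangement K V) (b : Module.Basis (Fin n) K V) :
    MvPolynomial (Fin n) K :=
  ∏ H ∈ A.finite.toFinset, linPoly b (definingForm H)

/-- The module `D(A) = {θ ∈ Der(S) | θ(Q(A)) ∈ Q(A) S}` of `A`-derivations. -/
def CentralArrangement.derivations (A : CentralArrangement K V) (b : Module.Basis (Fin n) K V) :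
    Submodule (MvPolynomial (Fin n) K)
      (Derivation K (MvPolynomial (Fin n) K) (MvPolynomial (Fin n) K)) where
  carrier := {θ | A.definingPoly b ∣ θ (A.definingPoly b)}
  add_mem' h₁ h₂ := by simpa using dvd_add h₁ h₂
  zero_mem' := by simp
  smul_mem' f θ h := by simpa using Dvd.dvd.mul_left h f

/-- A non-zero derivation all of whose coefficients `θ(x_i)` are homogeneous of degree `p`. -/
def IsHomogeneousDerivation
    (θ : Derivation K (MvPolynomial (Fin n) K) (MvPolynomial (Fin n) K)) (p : ℕ) : Prop :=
  θ ≠ 0 ∧ ∀ i, (θ (X i)).IsHomogeneous p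

/-- `A` is free with multiset of exponents `E`: with respect to linear coordinates of `V`, the
module `D(A)` has a homogeneous basis whose multiset of degrees is `E`. (Neither the existence of
such a basis nor `E` depends on the coordinates.) -/
def CentralArrangement.HasExponents (A : CentralArrangement K V) (E : Multiset ℕ) : Prop :=
  ∃ (n : ℕ) (b : Module.Basis (Fin n) K V)
    (θ : Module.Basis (Fin n) (MvPolynomial (Fin n) K) (A.derivations b)) (e : Fin n → ℕ),
    (∀ i, IsHomogeneousDerivation
      (θ i : Derivation K (MvPolynomial (Fin n) K) (MvPolynomial (Fin n) K)) (e i)) ∧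
    E = Finset.univ.val.map e

end Poly

section Operations

variable {K : Type*} [Field K] {V : Type*} [AddCommGroup V] [Module K V]

/-- The deletion `A' = A \ {H}`. -/
def CentralArrangement.delete (A : CentralArrangement K V) (H : Submodule K V) :
    CentralArrangement K V where
  hyperplanes := A.hyperplanes \ {H}
  finite := A.finite.sdiff
  isHyperplane Y hY := A.isHyperplane Y hY.1

/-- The restriction `A^X = {H ∩ X | H ∈ A, X ⊄ H}`, an arrangement in the vector space `X`. -/
def CentralArrangement.restrict (A : CentralArrangement K V) (X : Submodule K V) :
    CentralArrangement K X where
  hyperplanes := {Y | ∃ H ∈ A.hyperplanes, ¬ X ≤ H ∧ Y = H.comap X.subtype}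
  finite := by
    refine (A.finite.image (fun H => H.comap X.subtype)).subset ?_
    rintro _ ⟨H, hH, -, rfl⟩
    exact ⟨H, hH, rfl⟩
  isHyperplane := by
    rintro _ ⟨H, hH, hX, rfl⟩
    obtain ⟨α, -, rfl⟩ := A.isHyperplane H hH
    refine ⟨α ∘ₗ X.subtype, fun h => hX fun x hx => ?_, by rw [LinearMap.ker_comp]⟩
    exact congrArg (fun f : Module.Dual K X => f ⟨x, hx⟩) h

/-- `X ∈ L(A)`: the subspace `X` is an intersection of members of `A` (`V` is the empty one). -/
def CentralArrangement.IsFlat (A : CentralArrangement K V) (X : Submodule K V) : Prop :=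
  ∃ B ⊆ A.hyperplanes, X = sInf B

end Operations

/-- The smallest class of arrangements that contains all empty arrangements in finite-dimensional
spaces, and contains `A` as soon as, for some `H ∈ A`, it contains the deletion `A'` and the
restriction `A''` and `exp(A'') ⊆ exp(A')`. -/
inductive InductivelyFree (K : Type*) [Field K] :
    ∀ (V : Type u) [AddCommGroup V] [Module K V], CentralArrangement K V → Prop
  | empty (V : Type u) [AddCommGroup V] [Module K V] [FiniteDimensional K V]
      (A : CentralArrangement K V) (hA : A.hyperplanes = ∅) : InductivelyFree K V A
  | add (V : Type u) [AddCommGroup V] [Module K V] (A : CentralArrangement K V)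
      (H : Submodule K V) (hH : H ∈ A.hyperplanes)
      (hdel : InductivelyFree K V (A.delete H))
      (hres : InductivelyFree K H (A.restrict H))
      (E' E'' : Multiset ℕ) (hE' : (A.delete H).HasExponents E')
      (hE'' : (A.restrict H).HasExponents E'') (hle : E'' ≤ E') : InductivelyFree K V A

section Accuracy

variable {K : Type*} [Field K] {V : Type u} [AddCommGroup V] [Module K V]

/-- `(X_1, …, X_ℓ)`, `ℓ = dim V`, is a witness for the accuracy of `A`: `A` is free with exponents
`e_1 ≤ … ≤ e_ℓ`, and `X_d` is a flat of dimension `d` such that `A^{X_d}` is free with exponents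
`(e_1, …, e_d)`, for `1 ≤ d ≤ ℓ`. Only the values `X d` with `1 ≤ d ≤ ℓ` matter. -/
def CentralArrangement.IsAccuracyWitness (A : CentralArrangement K V)
    (X : ℕ → Submodule K V) : Prop :=
  ∃ e : List ℕ, e.Pairwise (· ≤ ·) ∧ A.HasExponents (e : Multiset ℕ) ∧
    ∀ d, 1 ≤ d → d ≤ Module.finrank K V →
      A.IsFlat (X d) ∧ Module.finrank K (X d) = d ∧
      (A.restrict (X d)).HasExponents (e.take d : Multiset ℕ)

/-- An accuracy witness that is a flag `X_1 ⊆ X_2 ⊆ ⋯ ⊆ X_ℓ`. -/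
def CentralArrangement.IsFlagWitness (A : CentralArrangement K V)
    (X : ℕ → Submodule K V) : Prop :=
  A.IsAccuracyWitness X ∧ ∀ d, 1 ≤ d → d + 1 ≤ Module.finrank K V → X d ≤ X (d + 1)

def CentralArrangement.FlagAccurate (A : CentralArrangement K V) : Prop :=
  ∃ X, A.IsFlagWitness X

def CentralArrangement.IndFlagAccurate (A : CentralArrangement K V) : Prop :=
  InductivelyFree K V A ∧ A.FlagAccurate ∧
    ∃ X, A.IsFlagWitness X ∧
      ∀ d, 1 ≤ d → d ≤ Module.finrank K V → InductivelyFree K (X d) (A.restrict (X d))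

end Accuracy

section Digraphic

variable {ℓ : ℕ}

/-- The arrangement in `ℝ^ℓ` attached to a digraph `G` on `ℓ` vertices (loops are disregarded) and
a weight `ψ`: `x_i - x_j = 0` for `i < j`, `x_i - x_j = 1` for every edge `(i, j)`, and `x_i = c`
for `c ∈ ψ(i)`. -/
def digraphicArrangement (G : Digraph (Fin ℓ)) (ψ : Fin ℓ → Finset ℤ) :
    AffineArrangement ℝ (Fin ℓ → ℝ) where
  hyperplanes :=
    {H | ∃ i j, i < j ∧ H = {x | x i - x j = 0}} ∪
    {H | ∃ i j, i ≠ j ∧ G.Adj i j ∧ H = {x | x i - x j = 1}} ∪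
    {H | ∃ i, ∃ c ∈ ψ i, H = {x | x i = (c : ℝ)}}
  finite := by
    refine Set.Finite.union (Set.Finite.union ?_ ?_) ?_
    · refine (Set.finite_range fun q : Fin ℓ × Fin ℓ =>
        {x : Fin ℓ → ℝ | x q.1 - x q.2 = 0}).subset ?_
      rintro _ ⟨i, j, -, rfl⟩
      exact ⟨(i, j), rfl⟩
    · refine (Set.finite_range fun q : Fin ℓ × Fin ℓ =>
        {x : Fin ℓ → ℝ | x q.1 - x q.2 = 1}).subset ?_
      rintro _ ⟨i, j, -, -, rfl⟩
      exact ⟨(i, j), rfl⟩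
    · refine (Set.finite_range fun q : (Σ i : Fin ℓ, ψ i) =>
        {x : Fin ℓ → ℝ | x q.1 = ((q.2 : ℤ) : ℝ)}).subset ?_
      rintro _ ⟨i, c, hc, rfl⟩
      exact ⟨⟨i, c, hc⟩, rfl⟩
  isHyperplane := by
    have key : ∀ i j : Fin ℓ, i ≠ j →
        ((LinearMap.proj i : Module.Dual ℝ (Fin ℓ → ℝ)) - LinearMap.proj j) ≠ 0 := by
      intro i j hij h
      have := congrArg (fun f : Module.Dual ℝ (Fin ℓ → ℝ) => f (Pi.single i 1)) h
      simp [hij] at this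
    rintro H ((⟨i, j, hij, rfl⟩ | ⟨i, j, hij, -, rfl⟩) | ⟨i, c, -, rfl⟩)
    · exact ⟨_, 0, key i j hij.ne, rfl⟩
    · exact ⟨_, 1, key i j hij, rfl⟩
    · refine ⟨LinearMap.proj i, c, fun h => ?_, rfl⟩
      have := congrArg (fun f : Module.Dual ℝ (Fin ℓ → ℝ) => f (Pi.single i 1)) h
      simp at this

/-- The digraph `T_ℓ^k` with edges `(i, j)`, `1 ≤ i < j ≤ ℓ - k + 1`; the vertex labelled `i` in
`{1, …, ℓ}` is the element `i - 1` of `Fin ℓ`. -/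
def tournament (ℓ k : ℕ) : Digraph (Fin ℓ) where
  Adj i j := i < j ∧ ((j : ℤ) + 1) ≤ (ℓ : ℤ) - k + 1

/-- The weight `ψ_ℓ^{p,k}`: with `i` running through the labels `1, …, ℓ`, it is
`[1 - min (ℓ - i + 1, k) - m, d]` for `i ≤ p` and `[- min (ℓ - i + 1, k) - m, d]` for `i > p`. -/
def shiWeight (ℓ m d p k : ℕ) (v : Fin ℓ) : Finset ℤ :=
  let i : ℤ := (v : ℤ) + 1
  if i ≤ p then Finset.Icc (1 - min ((ℓ : ℤ) - i + 1) k - m) d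
  else Finset.Icc (- min ((ℓ : ℤ) - i + 1) k - m) d

/-- The Shi descendant `𝒜^{p,k}_ℓ(m,d)`, the entry in row `p` and column `k` of the Shi descendant
matrix. -/
def shiDescendant (ℓ m d p k : ℕ) : AffineArrangement ℝ (Fin ℓ → ℝ) :=
  digraphicArrangement (tournament ℓ k) (shiWeight ℓ m d p k)

end Digraphic

end HypArr

end

/-! The cone is assembled one hyperplane at a time by the addition theorem: if A \ {H} has exponents
{k} + E and A^H has exponents E, then A has exponents {k + 1} + E. Inductive freeness follows along
the way. The flag comes with it: when exp(A) is the list for A^H followed by one more entry, a flag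
for A^H, completed by V, is a flag for A. So each step must end with an addition whose restriction
omits the last exponent.

Consider configurations with vertices S, braid forms x_i - x_j on S, Shi forms x_i - x_j - z for i <
j in T, and integer levels x_i = c z. For T = S take the levels c - N, ..., c at every vertex, with
c - N - 1 added at the vertices of an up-closed set U (`isAccurateConfig_stepLevels`). Let p be the
least element of U. Deleting x_p = (c - N - 1) z replaces U by U \ {p}. On that hyperplane the braid
forms give every other vertex the level c - N - 1, and the Shi forms give c - N below p and c - N -
2 above p. The restriction is therefore of the same kind, on S \ {p}, with N + 1 and U \ {p}. Since
|S| + N is unchanged, the addition theorem turns one exponent |S| + N into |S| + N + 1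
(`IsAccurateConfig.insert_level`). Once U = S, the situation is that of N + 1 with U empty.

The start, N = 0 and U empty, has a single level at each vertex. A linear change of coordinates
makes the least vertex an end of no Shi edge (`IsAccurateConfig.change_root`). Such a vertex r, if
its levels are levels of all other vertices, is added by a modular extension
(`IsAccurateConfig.insert_vertex`): every new hyperplane has the same type of restriction, and the
new exponent is the number of levels of r plus the number of other vertices.

For the Shi descendant, the first ℓ + 1 - k vertices form a step configuration and the others are
adjoined in increasing order by modular extensions. The loss of levels is balanced by the growing
number of earlier vertices, hence the independence of k.

Freeness is handled through Saito's criterion; uniqueness of the exponents follows by counting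
degrees of homogeneous generators. -/

noncomputable section

namespace HypArr

universe u

open MvPolynomial

/-! ### Homogeneous polynomials: components, divisors, determinants -/

section HomogeneousPolynomials

variable {σ : Type*} {K : Type*} [Field K]

theorem homogeneousComponent_mul_of_isHomogeneous {q p : MvPolynomial σ K} {e : ℕ}
    (hp : p.IsHomogeneous e) (d : ℕ) :
    homogeneousComponent d (q * p) =
      if e ≤ d then homogeneousComponent (d - e) q * p else 0 := by
  conv_lhs => rw [← sum_homogeneousComponent q, Finset.sum_mul, map_sum]
  have h1 : ∀ k, homogeneousComponent d (homogeneousComponent k q * p) =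
      if d = k + e then homogeneousComponent k q * p else 0 := fun k =>
    homogeneousComponent_of_mem ((homogeneousComponent_isHomogeneous k q).mul hp)
  simp only [h1]
  split_ifs with he
  · rw [Finset.sum_eq_single (d - e)]
    · rw [if_pos (by omega)]
    · intro k _ hk
      rw [if_neg (by omega)]
    · intro hk
      rw [Finset.mem_range, not_lt, Nat.succ_le_iff] at hk
      rw [homogeneousComponent_eq_zero _ _ hk, zero_mul, ite_self]
  · exact Finset.sum_eq_zero fun k _ => if_neg (by omega)

/-- Comparing components of degree e in q = p s allows s to be replaced by its component of degree e
- b. The last clause is needed because the subtraction is truncated: for e < b it forces q = 0. -/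
theorem exists_isHomogeneous_of_dvd {p q : MvPolynomial σ K} {b e : ℕ} (hp : p.IsHomogeneous b)
    (hq : q.IsHomogeneous e) (h : p ∣ q) :
    ∃ r : MvPolynomial σ K, r.IsHomogeneous (e - b) ∧ q = r * p ∧ (e < b → r = 0) := by
  obtain ⟨s, rfl⟩ := h
  have h1 := homogeneousComponent_of_mem (m := e)
    (show p * s ∈ homogeneousSubmodule σ K e from hq)
  rw [if_pos rfl, mul_comm, homogeneousComponent_mul_of_isHomogeneous hp] at h1
  by_cases hbe : b ≤ e
  · rw [if_pos hbe] at h1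
    exact ⟨_, homogeneousComponent_isHomogeneous _ _, by rw [mul_comm]; exact h1.symm,
      fun h => by omega⟩
  · rw [if_neg hbe] at h1
    exact ⟨0, isHomogeneous_zero _ _ _, by rw [mul_comm, ← h1, zero_mul], fun _ => rfl⟩

theorem exists_eq_C_mul_of_dvd {p q : MvPolynomial σ K} {e : ℕ} (hp : p.IsHomogeneous e)
    (hq : q.IsHomogeneous e) (h : p ∣ q) (hq0 : q ≠ 0) : ∃ c : K, c ≠ 0 ∧ q = C c * p := by
  obtain ⟨r, hr, rfl, -⟩ := exists_isHomogeneous_of_dvd hp hq h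
  rw [Nat.sub_self, ← totalDegree_zero_iff_isHomogeneous, totalDegree_eq_zero_iff_eq_C] at hr
  refine ⟨coeff 0 r, fun h0 => hq0 ?_, by rw [← hr]⟩
  rw [hr, h0, C_0, zero_mul]

theorem isHomogeneous_det {n : ℕ} {M : Matrix (Fin n) (Fin n) (MvPolynomial σ K)} {e : Fin n → ℕ}
    (hM : ∀ i j, (M i j).IsHomogeneous (e i)) : M.det.IsHomogeneous (∑ i, e i) := by
  rw [Matrix.det_apply]
  refine IsHomogeneous.sum _ _ _ fun τ _ => ?_
  have h1 : (∏ i, M (τ i) i).IsHomogeneous (∑ i, e (τ i)) :=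
    IsHomogeneous.prod _ _ _ fun i _ => hM _ _
  rw [Equiv.sum_comp τ e] at h1
  rcases Int.units_eq_one_or (Equiv.Perm.sign τ) with h | h <;> rw [h]
  · simpa using h1
  · simpa using h1.neg

end HomogeneousPolynomials

/-! ### Linear forms as polynomials, and logarithmic derivations -/

section LinearPolynomials

variable {K : Type*} [Field K] {V : Type*} [AddCommGroup V] [Module K V] {n : ℕ}

theorem linPoly_add (b : Module.Basis (Fin n) K V) (α β : Module.Dual K V) :
    linPoly b (α + β) = linPoly b α + linPoly b β := by
  simp [linPoly, add_mul, Finset.sum_add_distrib]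

theorem linPoly_smul (b : Module.Basis (Fin n) K V) (c : K) (α : Module.Dual K V) :
    linPoly b (c • α) = C c * linPoly b α := by
  simp [linPoly, Finset.mul_sum, mul_assoc]

theorem coeff_linPoly (b : Module.Basis (Fin n) K V) (α : Module.Dual K V) (i : Fin n) :
    coeff (Finsupp.single i 1) (linPoly b α) = α (b i) := by
  classical
  simp only [linPoly, coeff_sum, coeff_C_mul, coeff_X]
  rw [Finset.sum_eq_single i]
  · simp
  · intro j _ hj
    simp [Finsupp.single_left_inj, hj]
  · simp

theorem linPoly_injective (b : Module.Basis (Fin n) K V) : Function.Injective (linPoly b) := by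
  intro α β h
  refine b.ext fun _ => ?_
  rw [← coeff_linPoly, h, coeff_linPoly]

theorem isHomogeneous_linPoly (b : Module.Basis (Fin n) K V) (α : Module.Dual K V) :
    (linPoly b α).IsHomogeneous 1 :=
  IsHomogeneous.sum _ _ _ fun _ _ => isHomogeneous_C_mul_X _ _

theorem linPoly_zero (b : Module.Basis (Fin n) K V) : linPoly b 0 = 0 := by
  simp [linPoly]

theorem linPoly_ne_zero (b : Module.Basis (Fin n) K V) {α : Module.Dual K V} (hα : α ≠ 0) :
    linPoly b α ≠ 0 := fun h => hα (linPoly_injective b (h.trans (linPoly_zero b).symm))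

theorem linPoly_coord (b : Module.Basis (Fin n) K V) (i : Fin n) : linPoly b (b.coord i) = X i := by
  classical
  rw [linPoly, Finset.sum_eq_single i]
  · simp
  · intro j _ hj
    simp [hj]
  · simp

theorem irreducible_linPoly (b : Module.Basis (Fin n) K V) {α : Module.Dual K V} (hα : α ≠ 0) :
    Irreducible (linPoly b α) := by
  refine irreducible_of_totalDegree_eq_one
    ((isHomogeneous_linPoly b α).totalDegree (linPoly_ne_zero b hα)) fun x hx => ?_
  refine isUnit_iff_ne_zero.2 fun h => linPoly_ne_zero b hα ?_
  ext m
  simpa [h] using hx m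

theorem exists_eq_smul_of_linPoly_dvd (b : Module.Basis (Fin n) K V) {α β : Module.Dual K V}
    (hβ : β ≠ 0) (h : linPoly b α ∣ linPoly b β) : ∃ c : K, c ≠ 0 ∧ β = c • α := by
  obtain ⟨c, hc, h⟩ := exists_eq_C_mul_of_dvd (isHomogeneous_linPoly b α)
    (isHomogeneous_linPoly b β) h (linPoly_ne_zero b hβ)
  exact ⟨c, hc, linPoly_injective b (by rw [h, linPoly_smul])⟩

theorem ker_eq_of_linPoly_dvd (b : Module.Basis (Fin n) K V) {α β : Module.Dual K V}
    (hβ : β ≠ 0) (h : linPoly b α ∣ linPoly b β) : LinearMap.ker α = LinearMap.ker β := by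
  obtain ⟨c, hc, rfl⟩ := exists_eq_smul_of_linPoly_dvd b hβ h
  exact (LinearMap.ker_smul α c hc).symm

theorem isRelPrime_linPoly (b : Module.Basis (Fin n) K V) {α β : Module.Dual K V} (hα : α ≠ 0)
    (hβ : β ≠ 0) (h : LinearMap.ker α ≠ LinearMap.ker β) :
    IsRelPrime (linPoly b α) (linPoly b β) :=
  (irreducible_linPoly b hα).isRelPrime_iff_not_dvd.2 fun hd => h (ker_eq_of_linPoly_dvd b hβ hd)

theorem exists_eq_smul_of_ker_eq {α β : Module.Dual K V} (hα : α ≠ 0) (hβ : β ≠ 0)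
    (h : LinearMap.ker α = LinearMap.ker β) : ∃ c : K, c ≠ 0 ∧ β = c • α := by
  obtain ⟨v, hv⟩ : ∃ v, α v = 1 := LinearMap.surjective hα 1
  have h2 : β = β v • α := by
    ext x
    have h3 : x - α x • v ∈ LinearMap.ker α := by simp [hv]
    rw [h, LinearMap.mem_ker, map_sub, map_smul, sub_eq_zero] at h3
    simp [h3, mul_comm]
  refine ⟨β v, fun h0 => hβ ?_, h2⟩
  rw [h2, h0, zero_smul]

theorem definingForm_spec {A : CentralArrangement K V} {H : Submodule K V}
    (hH : H ∈ A.hyperplanes) : definingForm H ≠ 0 ∧ H = LinearMap.ker (definingForm H) := by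
  have h := A.isHyperplane H hH
  rw [definingForm, dif_pos h]
  exact h.choose_spec

/-- The value at the linear form `α` of the derivation with coefficients `v`. -/
def applyForm (b : Module.Basis (Fin n) K V) (α : Module.Dual K V)
    (v : Fin n → MvPolynomial (Fin n) K) : MvPolynomial (Fin n) K :=
  ∑ i, C (α (b i)) * v i

theorem applyForm_eq_derivation (b : Module.Basis (Fin n) K V) (α : Module.Dual K V)
    (θ : Derivation K (MvPolynomial (Fin n) K) (MvPolynomial (Fin n) K)) :
    applyForm b α (fun i => θ (X i)) = θ (linPoly b α) := by
  simp [applyForm, linPoly, Derivation.leibniz, MvPolynomial.derivation_C]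

theorem applyForm_smul_left (b : Module.Basis (Fin n) K V) (c : K) (α : Module.Dual K V)
    (v : Fin n → MvPolynomial (Fin n) K) : applyForm b (c • α) v = C c * applyForm b α v := by
  simp [applyForm, Finset.mul_sum, mul_assoc]

theorem applyForm_add_right (b : Module.Basis (Fin n) K V) (α : Module.Dual K V)
    (v w : Fin n → MvPolynomial (Fin n) K) :
    applyForm b α (v + w) = applyForm b α v + applyForm b α w := by
  simp [applyForm, mul_add, Finset.sum_add_distrib]

theorem applyForm_smul_right (b : Module.Basis (Fin n) K V) (α : Module.Dual K V)
    (f : MvPolynomial (Fin n) K) (v : Fin n → MvPolynomial (Fin n) K) :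
    applyForm b α (f • v) = f * applyForm b α v := by
  simp only [applyForm, Finset.mul_sum, Pi.smul_apply, smul_eq_mul]
  exact Finset.sum_congr rfl fun i _ => by ring

/-- `v` is the vector of coefficients of a derivation `θ` with `θ(α_H) ∈ α_H S` for all `H ∈ A`. -/
def CentralArrangement.IsLog (A : CentralArrangement K V) (b : Module.Basis (Fin n) K V)
    (v : Fin n → MvPolynomial (Fin n) K) : Prop :=
  ∀ α : Module.Dual K V, α ≠ 0 → LinearMap.ker α ∈ A.hyperplanes → linPoly b α ∣ applyForm b α v

/-- Two forms of one hyperplane are proportional, so the chosen form suffices. Quantifying over all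
forms in `IsLog` keeps that choice out of later arguments. -/
theorem CentralArrangement.IsLog.of_definingForm {A : CentralArrangement K V}
    {b : Module.Basis (Fin n) K V} {v : Fin n → MvPolynomial (Fin n) K}
    (h : ∀ H ∈ A.hyperplanes, linPoly b (definingForm H) ∣ applyForm b (definingForm H) v) :
    A.IsLog b v := by
  intro α hα hA
  obtain ⟨h0, h1⟩ := definingForm_spec hA
  obtain ⟨c, hc, h2⟩ := exists_eq_smul_of_ker_eq h0 hα h1.symm
  rw [h2, linPoly_smul, applyForm_smul_left]
  exact mul_dvd_mul_left _ (h _ hA)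

theorem CentralArrangement.IsLog.add {A : CentralArrangement K V}
    {b : Module.Basis (Fin n) K V} {v w : Fin n → MvPolynomial (Fin n) K}
    (hv : A.IsLog b v) (hw : A.IsLog b w) : A.IsLog b (v + w) := by
  intro α hα hA
  rw [applyForm_add_right]
  exact dvd_add (hv α hα hA) (hw α hα hA)

theorem CentralArrangement.IsLog.smul {A : CentralArrangement K V}
    {b : Module.Basis (Fin n) K V} (f : MvPolynomial (Fin n) K) {v : Fin n → MvPolynomial (Fin n) K}
    (hv : A.IsLog b v) : A.IsLog b (f • v) := by
  intro α hα hA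
  rw [applyForm_smul_right]
  exact (hv α hα hA).mul_left _

variable (A : CentralArrangement K V) (b : Module.Basis (Fin n) K V)

theorem CentralArrangement.pairwise_isRelPrime :
    (A.finite.toFinset : Set (Submodule K V)).Pairwise
      fun H H' => IsRelPrime (linPoly b (definingForm H)) (linPoly b (definingForm H')) := by
  intro H hH H' hH' hne
  simp only [Set.Finite.coe_toFinset] at hH hH'
  obtain ⟨h0, h1⟩ := definingForm_spec hH
  obtain ⟨h0', h1'⟩ := definingForm_spec hH'
  exact isRelPrime_linPoly b h0 h0' fun h => hne (h1.trans (h.trans h1'.symm))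

theorem CentralArrangement.definingPoly_dvd {f : MvPolynomial (Fin n) K}
    (h : ∀ H ∈ A.hyperplanes, linPoly b (definingForm H) ∣ f) : A.definingPoly b ∣ f :=
  Finset.prod_dvd_of_isRelPrime (A.pairwise_isRelPrime b) fun H hH => h H (by simpa using hH)

theorem CentralArrangement.isHomogeneous_definingPoly :
    (A.definingPoly b).IsHomogeneous A.hyperplanes.ncard := by
  have := IsHomogeneous.prod A.finite.toFinset (fun H => linPoly b (definingForm H)) (fun _ => 1)
    fun H _ => isHomogeneous_linPoly b _
  rwa [Finset.sum_const, smul_eq_mul, mul_one, ← Set.ncard_eq_toFinset_card _ A.finite] at this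

theorem CentralArrangement.definingPoly_ne_zero : A.definingPoly b ≠ 0 :=
  Finset.prod_ne_zero_iff.2 fun _ hH =>
    linPoly_ne_zero b (definingForm_spec ((Set.Finite.mem_toFinset _).1 hH)).1

theorem derivation_prod {R S ι : Type*} [CommRing R] [CommRing S] [Algebra R S] [DecidableEq ι]
    (θ : Derivation R S S) (s : Finset ι) (f : ι → S) :
    θ (∏ i ∈ s, f i) = ∑ i ∈ s, (∏ j ∈ s.erase i, f j) * θ (f i) := by
  induction s using Finset.induction_on with
  | empty => simp
  | insert a s ha ih =>
    rw [Finset.prod_insert ha, Derivation.leibniz, ih, Finset.sum_insert ha,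
      Finset.erase_insert ha, add_comm, smul_eq_mul, smul_eq_mul, Finset.mul_sum]
    congr 1
    refine Finset.sum_congr rfl fun i hi => ?_
    have hne : a ≠ i := fun h => ha (h ▸ hi)
    rw [Finset.erase_insert_of_ne hne, Finset.prod_insert (by simp [ha]), mul_assoc]

/-- By the Leibniz rule, modulo α_H only the summand (Q/α_H) θ(α_H) of θ(Q) survives, and Q/α_H is
prime to α_H. Conversely, every α_H divides θ(Q), and the α_H are pairwise coprime. -/
theorem CentralArrangement.mem_derivations_iff
    (θ : Derivation K (MvPolynomial (Fin n) K) (MvPolynomial (Fin n) K)) :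
    θ ∈ A.derivations b ↔ A.IsLog b fun i => θ (X i) := by
  classical
  change A.definingPoly b ∣ θ (A.definingPoly b) ↔ _
  have hθ : θ (A.definingPoly b) = ∑ H ∈ A.finite.toFinset,
      (∏ H' ∈ A.finite.toFinset.erase H, linPoly b (definingForm H')) *
        θ (linPoly b (definingForm H)) := by
    exact derivation_prod θ _ _
  constructor
  · intro h
    refine CentralArrangement.IsLog.of_definingForm fun H hH => ?_
    have hH' : H ∈ A.finite.toFinset := by simpa using hH
    rw [applyForm_eq_derivation]
    have h1 : linPoly b (definingForm H) ∣ A.definingPoly b :=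
      Finset.dvd_prod_of_mem (fun H => linPoly b (definingForm H)) hH'
    have h2 := h1.trans h
    rw [hθ, ← Finset.add_sum_erase _ _ hH'] at h2
    have h3 : linPoly b (definingForm H) ∣ ∑ H₁ ∈ A.finite.toFinset.erase H,
        (∏ H' ∈ A.finite.toFinset.erase H₁, linPoly b (definingForm H')) *
          θ (linPoly b (definingForm H₁)) := by
      refine Finset.dvd_sum fun H₁ hH₁ => Dvd.dvd.mul_right ?_ _
      exact Finset.dvd_prod_of_mem (fun H => linPoly b (definingForm H))
        (Finset.mem_erase.2 ⟨(Finset.mem_erase.1 hH₁).1.symm, hH'⟩)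
    have h4 := (dvd_add_left h3).1 h2
    refine IsRelPrime.dvd_of_dvd_mul_left ?_ h4
    refine IsRelPrime.prod_right fun H' hH'' => ?_
    rw [Finset.mem_erase] at hH''
    exact A.pairwise_isRelPrime b (by simpa using hH) (by simpa using hH''.2) hH''.1.symm
  · intro h
    refine A.definingPoly_dvd b fun H hH => ?_
    have hH' : H ∈ A.finite.toFinset := by simpa using hH
    rw [hθ]
    refine Finset.dvd_sum fun H₁ hH₁ => ?_
    by_cases hne : H₁ = H
    · subst hne
      obtain ⟨h0, h1⟩ := definingForm_spec hH
      have := h _ h0 (h1 ▸ hH)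
      rw [applyForm_eq_derivation] at this
      exact this.mul_left _
    · exact Dvd.dvd.mul_right (Finset.dvd_prod_of_mem (fun H => linPoly b (definingForm H))
        (Finset.mem_erase.2 ⟨Ne.symm hne, hH'⟩)) _

end LinearPolynomials

/-! ### Saito's criterion and counting of degrees -/

section Saito

variable {K : Type*} [Field K] {V : Type*} [AddCommGroup V] [Module K V] {n : ℕ}
  (A : CentralArrangement K V) (b : Module.Basis (Fin n) K V)

/-- If c is the column of coefficients of α_H, the rows being logarithmic means M c = α_H w.
Multiplication by the adjugate gives det M • c = α_H • adj(M) w, and some entry of c is a non-zero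
scalar, so α_H divides det M. -/
theorem CentralArrangement.definingPoly_dvd_det
    {M : Matrix (Fin n) (Fin n) (MvPolynomial (Fin n) K)} (hM : ∀ i, A.IsLog b (M i)) :
    A.definingPoly b ∣ M.det := by
  refine A.definingPoly_dvd b fun H hH => ?_
  obtain ⟨h0, h1⟩ := definingForm_spec hH
  set α := definingForm H with hα
  choose w hw using fun i => hM i α h0 (h1 ▸ hH)
  have h2 : M.mulVec (fun j => C (α (b j))) = linPoly b α • w := by
    ext1 i
    rw [Pi.smul_apply, smul_eq_mul, ← hw i, applyForm, Matrix.mulVec, dotProduct]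
    exact Finset.sum_congr rfl fun j _ => mul_comm _ _
  have h3 := congrArg M.adjugate.mulVec h2
  rw [Matrix.mulVec_mulVec, Matrix.adjugate_mul, Matrix.mulVec_smul, Matrix.smul_mulVec,
    Matrix.one_mulVec] at h3
  obtain ⟨i, hi⟩ : ∃ i, α (b i) ≠ 0 := by
    by_contra! hcon
    exact h0 (b.ext fun i => by simpa using hcon i)
  have h4 := congrFun h3 i
  simp only [Pi.smul_apply, smul_eq_mul] at h4
  have hu : IsUnit (C (α (b i)) : MvPolynomial (Fin n) K) := (isUnit_iff_ne_zero.2 hi).map C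
  exact hu.dvd_mul_right.1 (Dvd.intro _ h4.symm)

/-- `E` is the multiset of degrees of a system of derivations of `A` that satisfies the
hypotheses of Saito's criterion. -/
def CentralArrangement.SaitoExponents (E : Multiset ℕ) : Prop :=
  ∃ (M : Matrix (Fin n) (Fin n) (MvPolynomial (Fin n) K)) (e : Fin n → ℕ),
    (∀ i, A.IsLog b (M i)) ∧ (∀ i j, (M i j).IsHomogeneous (e i)) ∧ M.det ≠ 0 ∧
    ∑ i, e i = A.hyperplanes.ncard ∧ E = Finset.univ.val.map e

variable {A b}

theorem det_eq_C_mul_definingPoly {M : Matrix (Fin n) (Fin n) (MvPolynomial (Fin n) K)}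
    {e : Fin n → ℕ} (hM : ∀ i, A.IsLog b (M i)) (hh : ∀ i j, (M i j).IsHomogeneous (e i))
    (hd : M.det ≠ 0) (he : ∑ i, e i = A.hyperplanes.ncard) :
    ∃ c : K, c ≠ 0 ∧ M.det = C c * A.definingPoly b :=
  exists_eq_C_mul_of_dvd (A.isHomogeneous_definingPoly b) (he ▸ isHomogeneous_det hh)
    (A.definingPoly_dvd_det b hM) hd

/-- Saito's criterion. -/
theorem exists_vecMul_eq_of_isLog {M : Matrix (Fin n) (Fin n) (MvPolynomial (Fin n) K)}
    {e : Fin n → ℕ} (hM : ∀ i, A.IsLog b (M i)) (hh : ∀ i j, (M i j).IsHomogeneous (e i))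
    (hd : M.det ≠ 0) (he : ∑ i, e i = A.hyperplanes.ncard)
    {v : Fin n → MvPolynomial (Fin n) K} (hv : A.IsLog b v) :
    ∃ g : Fin n → MvPolynomial (Fin n) K, Matrix.vecMul g M = v := by
  obtain ⟨c, hc, hdet⟩ := det_eq_C_mul_definingPoly hM hh hd he
  -- Each Cramer numerator is the determinant of M with one row replaced by v; its rows are still
  -- logarithmic, so Q divides it. As det M is a scalar multiple of Q, Cramer's rule then has
  -- polynomial solutions.
  have h1 : ∀ i, A.definingPoly b ∣ M.transpose.cramer v i := by
    intro i
    rw [Matrix.cramer_transpose_apply]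
    refine A.definingPoly_dvd_det b fun j => ?_
    by_cases hj : j = i
    · subst hj
      simpa using hv
    · rw [Matrix.updateRow_ne hj]
      exact hM j
  choose g hg using h1
  have h2 := Matrix.mulVec_cramer M.transpose v
  rw [Matrix.mulVec_transpose, Matrix.det_transpose,
    show M.transpose.cramer v = A.definingPoly b • g from funext hg, Matrix.smul_vecMul, hdet,
    mul_comm, mul_smul] at h2
  have h3 : Matrix.vecMul g M = (C c : MvPolynomial (Fin n) K) • v := by
    ext1 j
    have := congrFun h2 j
    simp only [Pi.smul_apply, smul_eq_mul] at this ⊢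
    exact mul_left_cancel₀ (A.definingPoly_ne_zero b) this
  refine ⟨(C c⁻¹ : MvPolynomial (Fin n) K) • g, ?_⟩
  rw [Matrix.smul_vecMul, h3, smul_smul, ← C_mul, inv_mul_cancel₀ hc, C_1, one_smul]

/-- Taking the component of degree f i in η_i = ∑ g_j M_j removes the rows with e_j > f i. Hence all
η_i lie in the span of the rows of degree at most d, and an independent family is no larger than a
spanning set. -/
theorem card_le_of_linearIndependent {M : Matrix (Fin n) (Fin n) (MvPolynomial (Fin n) K)}
    {e : Fin n → ℕ} (hh : ∀ i j, (M i j).IsHomogeneous (e i))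
    {ι : Type*} [Fintype ι] {η : ι → Fin n → MvPolynomial (Fin n) K}
    (hη : LinearIndependent (MvPolynomial (Fin n) K) η) {f : ι → ℕ}
    (hf : ∀ i j, (η i j).IsHomogeneous (f i)) {d : ℕ} (hd : ∀ i, f i ≤ d)
    (hspan : ∀ i, ∃ g : Fin n → MvPolynomial (Fin n) K, Matrix.vecMul g M = η i) :
    Fintype.card ι ≤ (Finset.univ.filter fun j => e j ≤ d).card := by
  classical
  have hs : Set.range η ≤ (Submodule.span (MvPolynomial (Fin n) K)
      (((Finset.univ.filter fun j => e j ≤ d).image M.row : Finset _) :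
        Set (Fin n → MvPolynomial (Fin n) K)) : Set _) := by
    rintro _ ⟨i, rfl⟩
    obtain ⟨g, hg⟩ := hspan i
    have h1 : η i = ∑ j, (if e j ≤ f i then homogeneousComponent (f i - e j) (g j) else 0) •
        M.row j := by
      ext1 k
      have h2 : homogeneousComponent (f i) (η i k) = η i k := by
        rw [homogeneousComponent_of_mem (hf i k), if_pos rfl]
      rw [← h2, ← hg, Matrix.vecMul, dotProduct, map_sum, Finset.sum_apply]
      refine Finset.sum_congr rfl fun j _ => ?_
      rw [homogeneousComponent_mul_of_isHomogeneous (hh j k)]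
      simp only [Pi.smul_apply, smul_eq_mul, Matrix.row]
      split_ifs <;> simp
    rw [h1]
    refine Submodule.sum_mem _ fun j _ => ?_
    split_ifs with hj
    · refine Submodule.smul_mem _ _ (Submodule.subset_span ?_)
      simp only [Finset.coe_image, Set.mem_image, Finset.mem_coe, Finset.mem_filter]
      exact ⟨j, ⟨Finset.mem_univ _, hj.trans (hd i)⟩, rfl⟩
    · simp
  have h := linearIndependent_le_span' η hη _ hs
  rw [Cardinal.mk_fintype, Nat.cast_le] at h
  refine h.trans ?_
  simp only [Finset.coe_sort_coe, Fintype.card_coe]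
  exact Finset.card_image_le

end Saito

/-! ### Independence of the coordinates -/

section ChangeOfCoordinates

variable {K : Type*} [Field K] {V : Type*} [AddCommGroup V] [Module K V] {n : ℕ}

theorem linPoly_sum {ι : Type*} (b : Module.Basis (Fin n) K V) (s : Finset ι)
    (α : ι → Module.Dual K V) : linPoly b (∑ i ∈ s, α i) = ∑ i ∈ s, linPoly b (α i) :=
  map_sum (⟨⟨linPoly b, linPoly_zero b⟩, linPoly_add b⟩ : Module.Dual K V →+ _) α s

theorem aeval_linPoly {R : Type*} [CommRing R] [Algebra K R] (b : Module.Basis (Fin n) K V)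
    (f : Fin n → R) (α : Module.Dual K V) :
    aeval f (linPoly b α) = ∑ i, algebraMap K R (α (b i)) * f i := by
  simp [linPoly]

/-- The substitution that expresses the coordinates with respect to `b` by those of `b'`. -/
def changeCoords (b b' : Module.Basis (Fin n) K V) :
    MvPolynomial (Fin n) K →ₐ[K] MvPolynomial (Fin n) K :=
  aeval fun j => linPoly b' (b.coord j)

theorem changeCoords_linPoly (b b' : Module.Basis (Fin n) K V) (α : Module.Dual K V) :
    changeCoords b b' (linPoly b α) = linPoly b' α := by
  rw [changeCoords, aeval_linPoly]
  conv_rhs => rw [← b.sum_dual_apply_smul_coord α, linPoly_sum]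
  exact Finset.sum_congr rfl fun i _ => (linPoly_smul _ _ _).symm

theorem changeCoords_injective (b b' : Module.Basis (Fin n) K V) :
    Function.Injective (changeCoords b b') := by
  have h : (changeCoords b' b).comp (changeCoords b b') = AlgHom.id K _ := by
    refine MvPolynomial.algHom_ext fun j => ?_
    rw [AlgHom.comp_apply, ← linPoly_coord b, changeCoords_linPoly, changeCoords_linPoly,
      AlgHom.id_apply]
  exact Function.LeftInverse.injective (g := changeCoords b' b) fun p => DFunLike.congr_fun h p

theorem isHomogeneous_changeCoords (b b' : Module.Basis (Fin n) K V) {p : MvPolynomial (Fin n) K}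
    {d : ℕ} (hp : p.IsHomogeneous d) : (changeCoords b b' p).IsHomogeneous d := by
  have := hp.aeval (g := fun j => linPoly b' (b.coord j)) fun j => isHomogeneous_linPoly b' _
  rwa [one_mul] at this

theorem isHomogeneous_applyForm (b : Module.Basis (Fin n) K V) (α : Module.Dual K V)
    {v : Fin n → MvPolynomial (Fin n) K} {d : ℕ} (hv : ∀ i, (v i).IsHomogeneous d) :
    (applyForm b α v).IsHomogeneous d :=
  IsHomogeneous.sum _ _ _ fun i _ => (hv i).C_mul _

/-- The new matrix arises from the old one by an invertible constant factor and an injective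
substitution. This is what allows the addition theorem to work in coordinates adapted to the
hyperplane. -/
theorem CentralArrangement.SaitoExponents.change {A : CentralArrangement K V}
    {b : Module.Basis (Fin n) K V} {E : Multiset ℕ} (h : A.SaitoExponents b E)
    (b' : Module.Basis (Fin n) K V) : A.SaitoExponents b' E := by
  obtain ⟨M, e, hM, hh, hd, he, rfl⟩ := h
  refine ⟨Matrix.of fun r i => changeCoords b b' (applyForm b (b'.coord i) (M r)), e,
    fun r => ?_, fun r i => isHomogeneous_changeCoords _ _ (isHomogeneous_applyForm _ _ (hh r)),
    ?_, he, rfl⟩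
  · intro α hα hA
    have h1 : applyForm b' α (fun i => changeCoords b b' (applyForm b (b'.coord i) (M r))) =
        changeCoords b b' (applyForm b α (M r)) := by
      have h2 : applyForm b α (M r) = ∑ i, C (α (b' i)) * applyForm b (b'.coord i) (M r) := by
        simp only [applyForm, Finset.mul_sum]
        rw [Finset.sum_comm]
        refine Finset.sum_congr rfl fun j _ => ?_
        simp only [← mul_assoc, ← C_mul, ← Finset.sum_mul, ← map_sum]
        congr 2
        have h3 := LinearMap.congr_fun (b'.sum_dual_apply_smul_coord α) (b j)
        rw [LinearMap.sum_apply] at h3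
        exact h3.symm
      rw [h2, map_sum, applyForm]
      refine Finset.sum_congr rfl fun i _ => ?_
      rw [map_mul, changeCoords, aeval_C]
      rfl
    change linPoly b' α ∣ applyForm b' α
      (fun i => changeCoords b b' (applyForm b (b'.coord i) (M r)))
    rw [h1, ← changeCoords_linPoly b b']
    exact map_dvd _ (hM r α hα hA)
  · have h1 : (Matrix.of fun r i => changeCoords b b' (applyForm b (b'.coord i) (M r))) =
        (changeCoords b b').mapMatrix
          (M * ((C : K →+* MvPolynomial (Fin n) K).mapMatrix (b'.toMatrix b)).transpose) := by
      ext1 r i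
      simp only [Matrix.of_apply, AlgHom.mapMatrix_apply, Matrix.map_apply, Matrix.mul_apply,
        Matrix.transpose_apply, RingHom.mapMatrix_apply, Module.Basis.toMatrix_apply, applyForm]
      congr 1
      exact Finset.sum_congr rfl fun j _ => mul_comm _ _
    rw [h1, ← AlgHom.map_det, Matrix.det_mul, Matrix.det_transpose, ← RingHom.map_det]
    refine (map_ne_zero_iff _ (changeCoords_injective b b')).2 (mul_ne_zero hd ?_)
    rw [Ne, map_eq_zero_iff _ (C_injective _ _)]
    have h2 := congrArg Matrix.det (b'.toMatrix_mul_toMatrix_flip b)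
    rw [Matrix.det_mul, Matrix.det_one] at h2
    exact left_ne_zero_of_mul (h2 ▸ one_ne_zero)

/-- `A` satisfies, in some coordinates, the hypotheses of Saito's criterion with degrees `E`. -/
def CentralArrangement.HasSaitoExponents (A : CentralArrangement K V) (E : Multiset ℕ) : Prop :=
  ∃ (n : ℕ) (b : Module.Basis (Fin n) K V), A.SaitoExponents b E

theorem CentralArrangement.HasSaitoExponents.saitoExponents {A : CentralArrangement K V}
    {E : Multiset ℕ} (h : A.HasSaitoExponents E) (b : Module.Basis (Fin n) K V) :
    A.SaitoExponents b E := by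
  obtain ⟨m, b', h⟩ := h
  obtain rfl : m = n := by
    rw [← Fintype.card_fin m, ← Module.finrank_eq_card_basis b', Module.finrank_eq_card_basis b,
      Fintype.card_fin]
  exact h.change b

end ChangeOfCoordinates

/-! ### Freeness and uniqueness of the exponents -/

section Exponents

variable {K : Type*} [Field K] {V : Type*} [AddCommGroup V] [Module K V] {n : ℕ}
  {A : CentralArrangement K V}

variable (A) in
/-- The coefficients `θ(x_1), …, θ(x_n)` of an `A`-derivation. -/
def CentralArrangement.coeffMap (b : Module.Basis (Fin n) K V) :
    A.derivations b →ₗ[MvPolynomial (Fin n) K] (Fin n → MvPolynomial (Fin n) K) where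
  toFun θ i := (θ : Derivation K (MvPolynomial (Fin n) K) (MvPolynomial (Fin n) K)) (X i)
  map_add' _ _ := rfl
  map_smul' _ _ := rfl

theorem CentralArrangement.coeffMap_injective (b : Module.Basis (Fin n) K V) :
    Function.Injective (A.coeffMap b) := fun _ _ h =>
  Subtype.ext (MvPolynomial.derivation_ext fun j => congrFun h j)

theorem CentralArrangement.exists_coeffMap_eq {b : Module.Basis (Fin n) K V}
    {v : Fin n → MvPolynomial (Fin n) K} (hv : A.IsLog b v) : ∃ θ, A.coeffMap b θ = v := by
  have hval : (fun j => mkDerivation K v (X j)) = v := funext fun j => mkDerivation_X K v j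
  exact ⟨⟨mkDerivation K v, (A.mem_derivations_iff b _).2 (hval.symm ▸ hv)⟩, hval⟩

/-- The rows are independent because the determinant is non-zero, and they generate by Saito's
criterion. -/
theorem CentralArrangement.HasSaitoExponents.hasExponents {E : Multiset ℕ}
    (h : A.HasSaitoExponents E) : A.HasExponents E := by
  obtain ⟨n, b, M, e, hM, hh, hd, he, rfl⟩ := h
  choose θ hθ using fun i => A.exists_coeffMap_eq (hM i)
  have hli : LinearIndependent (MvPolynomial (Fin n) K) θ := by
    refine LinearIndependent.of_comp (A.coeffMap b) ?_
    have h1 : A.coeffMap b ∘ θ = fun i => M i := funext hθ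
    rw [h1]
    exact Matrix.linearIndependent_rows_of_det_ne_zero hd
  have hsp : ⊤ ≤ Submodule.span (MvPolynomial (Fin n) K) (Set.range θ) := by
    intro η _
    obtain ⟨g, hg⟩ := exists_vecMul_eq_of_isLog hM hh hd he ((A.mem_derivations_iff b η).1 η.2)
    have h1 : η = ∑ i, g i • θ i := by
      refine A.coeffMap_injective b ?_
      rw [map_sum]
      refine hg.symm.trans ?_
      simp only [map_smul, hθ]
      exact Matrix.vecMul_eq_sum g M
    rw [h1]
    exact Submodule.sum_mem _ fun i _ => Submodule.smul_mem _ _ (Submodule.subset_span ⟨i, rfl⟩)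
  refine ⟨n, b, Module.Basis.mk hli hsp, e, fun i => ?_, rfl⟩
  rw [Module.Basis.mk_apply]
  refine ⟨fun h0 => hli.ne_zero i (Subtype.ext h0), fun j => ?_⟩
  have h1 : A.coeffMap b (θ i) j = M i j := congrFun (hθ i) j
  change (A.coeffMap b (θ i) j).IsHomogeneous (e i)
  rw [h1]
  exact hh i j

theorem card_filter_le_eq_count_add {ι : Type*} [Fintype ι] (g : ι → ℕ) (d : ℕ) :
    (Finset.univ.filter fun i => g i ≤ d).card =
      (Finset.univ.val.map g).count d + if d = 0 then 0 else
        (Finset.univ.filter fun i => g i ≤ d - 1).card := by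
  classical
  rw [Multiset.count_map]
  change _ = (Finset.univ.filter fun i => d = g i).card + _
  split_ifs with hd
  · subst hd
    rw [add_zero]
    congr 1
    ext i
    simp [eq_comm]
  · rw [← Finset.card_union_of_disjoint]
    · congr 1
      ext i
      simp only [Finset.mem_filter, Finset.mem_univ, true_and, Finset.mem_union]
      omega
    · rw [Finset.disjoint_filter]
      intro i _ h1 h2
      omega

/-- Multiplicities are differences of consecutive cumulative counts. -/
theorem map_eq_map_of_card_filter_le {ι κ : Type*} [Fintype ι] [Fintype κ] {e : ι → ℕ} {f : κ → ℕ}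
    (h : ∀ d, (Finset.univ.filter fun i => e i ≤ d).card =
      (Finset.univ.filter fun i => f i ≤ d).card) :
    Finset.univ.val.map e = Finset.univ.val.map f := by
  ext d
  have h1 := card_filter_le_eq_count_add e d
  have h2 := card_filter_le_eq_count_add f d
  rw [h d, h2] at h1
  split_ifs at h1
  · omega
  · rw [h (d - 1)] at h1
    omega

theorem card_filter_le_card_filter {M N : Matrix (Fin n) (Fin n) (MvPolynomial (Fin n) K)}
    {e f : Fin n → ℕ} (hM : ∀ i j, (M i j).IsHomogeneous (e i))
    (hN : ∀ i j, (N i j).IsHomogeneous (f i))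
    (hli : LinearIndependent (MvPolynomial (Fin n) K) N.row)
    (hspan : ∀ i, ∃ g : Fin n → MvPolynomial (Fin n) K, Matrix.vecMul g M = N i) (d : ℕ) :
    (Finset.univ.filter fun i => f i ≤ d).card ≤ (Finset.univ.filter fun i => e i ≤ d).card := by
  have h1 : LinearIndependent (MvPolynomial (Fin n) K) fun i : {i // f i ≤ d} => N.row i :=
    hli.comp _ Subtype.val_injective
  have := card_le_of_linearIndependent hM h1 (f := fun i => f i) (fun i j => hN i j)
    (fun i => i.2) fun i => hspan i
  rwa [Fintype.card_subtype] at this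

/-- Two homogeneous independent families that generate each other have, for every d, equally many
members of degree at most d. The arbitrary basis generates by definition and the Saito system by the
criterion, so nothing about the determinant of the arbitrary basis is required. -/
theorem CentralArrangement.HasExponents.eq_of_hasSaitoExponents {E E' : Multiset ℕ}
    (h : A.HasExponents E) (h' : A.HasSaitoExponents E') : E = E' := by
  obtain ⟨n, b, θ, e, hθ, rfl⟩ := h
  obtain ⟨M, e', hM, hh, hd, he, rfl⟩ := h'.saitoExponents b
  obtain ⟨N, hNθ⟩ : ∃ N : Matrix (Fin n) (Fin n) (MvPolynomial (Fin n) K),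
      ∀ i, N.row i = A.coeffMap b (θ i) := ⟨fun i => A.coeffMap b (θ i), fun _ => rfl⟩
  have hNspan : ∀ v, A.IsLog b v → ∃ g, Matrix.vecMul g N = v := by
    intro v hv
    obtain ⟨η, rfl⟩ := A.exists_coeffMap_eq hv
    refine ⟨θ.repr η, ?_⟩
    rw [Matrix.vecMul_eq_sum]
    conv_rhs => rw [← θ.sum_repr η, map_sum]
    refine Finset.sum_congr rfl fun i _ => ?_
    rw [map_smul, ← hNθ i]
    rfl
  have hNli : LinearIndependent (MvPolynomial (Fin n) K) N.row := by
    rw [show N.row = A.coeffMap b ∘ θ from funext hNθ]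
    exact θ.linearIndependent.map_injOn (A.coeffMap b) (A.coeffMap_injective b).injOn
  have hMli : LinearIndependent (MvPolynomial (Fin n) K) M.row :=
    Matrix.linearIndependent_rows_of_det_ne_zero hd
  have hN : ∀ i, A.IsLog b (N.row i) := fun i => by
    rw [hNθ]
    exact (A.mem_derivations_iff b _).1 (θ i).2
  have hNh : ∀ i j, (N i j).IsHomogeneous (e i) := fun i j => by
    have h1 : N i j = A.coeffMap b (θ i) j := congrFun (hNθ i) j
    rw [h1]
    exact (hθ i).2 j
  refine map_eq_map_of_card_filter_le fun d => le_antisymm ?_ ?_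
  · exact card_filter_le_card_filter hh hNh hNli
      (fun i => exists_vecMul_eq_of_isLog hM hh hd he (hN i)) d
  · exact card_filter_le_card_filter hNh hh hMli (fun i => hNspan _ (hM i)) d

end Exponents

/-! ### Derivations modulo the form of a hyperplane -/

section RestrictionToHyperplane

variable {K : Type*} [Field K] {V : Type*} [AddCommGroup V] [Module K V] {n : ℕ}

/-- The substitution `x_0 ↦ 0`, `x_{i+1} ↦ x_i`. -/
def evalZero (K : Type*) [Field K] (n : ℕ) :
    MvPolynomial (Fin (n + 1)) K →ₐ[K] MvPolynomial (Fin n) K :=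
  aeval (Fin.cons 0 X)

theorem evalZero_X_zero : evalZero K n (X 0) = 0 := by
  simp [evalZero]

theorem evalZero_X_succ (i : Fin n) : evalZero K n (X i.succ) = X i := by
  simp [evalZero]

theorem evalZero_C (c : K) : evalZero K n (C c) = C c := by
  simp [evalZero]

theorem evalZero_rename (p : MvPolynomial (Fin n) K) : evalZero K n (rename Fin.succ p) = p := by
  rw [evalZero, aeval_rename]
  exact aeval_X_left_apply p

theorem X_zero_dvd_sub_rename_evalZero (p : MvPolynomial (Fin (n + 1)) K) :
    X 0 ∣ p - rename Fin.succ (evalZero K n p) := by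
  induction p using MvPolynomial.induction_on with
  | C a => simp
  | add p q hp hq =>
    have := dvd_add hp hq
    rw [map_add, map_add]
    convert this using 1
    ring
  | mul_X p i hp =>
    rw [map_mul, map_mul]
    refine Fin.cases ?_ (fun j => ?_) i
    · rw [evalZero_X_zero, map_zero, mul_zero, sub_zero]
      exact dvd_mul_left _ _
    · rw [evalZero_X_succ, rename_X, ← sub_mul]
      exact hp.mul_right _

theorem evalZero_eq_zero_iff {p : MvPolynomial (Fin (n + 1)) K} :
    evalZero K n p = 0 ↔ X 0 ∣ p := by
  constructor
  · intro h
    have := X_zero_dvd_sub_rename_evalZero p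
    rwa [h, map_zero, sub_zero] at this
  · rintro ⟨q, rfl⟩
    rw [map_mul, evalZero_X_zero, zero_mul]

theorem isHomogeneous_evalZero {p : MvPolynomial (Fin (n + 1)) K} {d : ℕ} (hp : p.IsHomogeneous d) :
    (evalZero K n p).IsHomogeneous d := by
  have := hp.aeval (g := (Fin.cons 0 X : Fin (n + 1) → MvPolynomial (Fin n) K)) (n := 1)
    (Fin.cases (isHomogeneous_zero _ _ _) fun i => by simpa using isHomogeneous_X K i)
  rwa [one_mul] at this

/-- The basis `b` of `V` extends the basis `b₀` of `ker α₀` by a vector at which `α₀` is `1`. -/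
structure IsAdapted (α₀ : Module.Dual K V) (b : Module.Basis (Fin (n + 1)) K V)
    (b₀ : Module.Basis (Fin n) K (LinearMap.ker α₀)) : Prop where
  apply_zero : α₀ (b 0) = 1
  succ : ∀ i, b i.succ = b₀ i

theorem exists_isAdapted {α₀ : Module.Dual K V} (hα₀ : α₀ ≠ 0)
    (b₀ : Module.Basis (Fin n) K (LinearMap.ker α₀)) :
    ∃ b : Module.Basis (Fin (n + 1)) K V, IsAdapted α₀ b b₀ := by
  obtain ⟨v, hv⟩ : ∃ v, α₀ v = 1 := LinearMap.surjective hα₀ 1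
  refine ⟨Module.Basis.mkFinCons v b₀ (fun c x hx h => ?_) (fun z => ⟨-α₀ z, ?_⟩), ?_, fun i => ?_⟩
  · have := congrArg α₀ h
    rwa [map_add, map_smul, hv, LinearMap.mem_ker.1 hx, map_zero, add_zero, smul_eq_mul,
      mul_one] at this
  · simp [hv]
  · simp [hv]
  · simp

variable {α₀ : Module.Dual K V} {b : Module.Basis (Fin (n + 1)) K V}
  {b₀ : Module.Basis (Fin n) K (LinearMap.ker α₀)}

namespace IsAdapted

theorem eq_coord (h : IsAdapted α₀ b b₀) : α₀ = b.coord 0 := by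
  refine b.ext fun i => Fin.cases ?_ (fun j => ?_) i
  · simp [h.apply_zero]
  · rw [h.succ, LinearMap.mem_ker.1 (b₀ j).2, ← h.succ]
    simp

theorem linPoly_eq (h : IsAdapted α₀ b b₀) : linPoly b α₀ = X 0 := by
  rw [h.eq_coord, linPoly_coord]

theorem applyForm_eq (h : IsAdapted α₀ b b₀)
    (v : Fin (n + 1) → MvPolynomial (Fin (n + 1)) K) :
    applyForm b α₀ v = v 0 := by
  rw [applyForm, Fin.sum_univ_succ, h.apply_zero, C_1, one_mul, add_eq_left]
  refine Finset.sum_eq_zero fun i _ => ?_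
  rw [h.succ, LinearMap.mem_ker.1 (b₀ i).2, C_0, zero_mul]

theorem evalZero_linPoly (h : IsAdapted α₀ b b₀) (α : Module.Dual K V) :
    evalZero K n (linPoly b α) = linPoly b₀ (α ∘ₗ (LinearMap.ker α₀).subtype) := by
  rw [evalZero, aeval_linPoly, Fin.sum_univ_succ, Fin.cons_zero, mul_zero, zero_add, linPoly]
  refine Finset.sum_congr rfl fun i _ => ?_
  rw [h.succ, Fin.cons_succ]
  rfl

theorem evalZero_applyForm (h : IsAdapted α₀ b b₀) (α : Module.Dual K V)
    {v : Fin (n + 1) → MvPolynomial (Fin (n + 1)) K} (hv : evalZero K n (v 0) = 0) :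
    evalZero K n (applyForm b α v) =
      applyForm b₀ (α ∘ₗ (LinearMap.ker α₀).subtype) fun i => evalZero K n (v i.succ) := by
  rw [applyForm, map_sum, Fin.sum_univ_succ, map_mul, hv, mul_zero, zero_add, applyForm]
  refine Finset.sum_congr rfl fun i _ => ?_
  rw [h.succ, map_mul, evalZero_C]
  rfl

/-- When θ(α₀) vanishes on ker α₀, θ preserves the ideal of α₀ and induces a derivation of the
quotient ring. Every member of the restriction is the trace of a member of the deletion, and its
divisibility relation passes to the quotient. -/
theorem isLog_restrict (h : IsAdapted α₀ b b₀) {A : CentralArrangement K V} {H₀ : Submodule K V}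
    (hH₀ : H₀ = LinearMap.ker α₀)
    {v : Fin (n + 1) → MvPolynomial (Fin (n + 1)) K} (hv : (A.delete H₀).IsLog b v)
    (hv0 : evalZero K n (v 0) = 0) :
    (A.restrict (LinearMap.ker α₀)).IsLog b₀ fun i => evalZero K n (v i.succ) := by
  rintro β hβ ⟨H, hH, hle, hker⟩
  obtain ⟨α, hα, rfl⟩ := A.isHyperplane H hH
  have hne : α ∘ₗ (LinearMap.ker α₀).subtype ≠ 0 := fun h0 => hle fun x hx =>
    LinearMap.congr_fun h0 ⟨x, hx⟩
  obtain ⟨c, hc, rfl⟩ := exists_eq_smul_of_ker_eq hne hβ (by rw [hker, LinearMap.ker_comp])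
  rw [linPoly_smul, applyForm_smul_left]
  refine mul_dvd_mul_left _ ?_
  rw [← h.evalZero_linPoly, ← h.evalZero_applyForm α hv0]
  refine map_dvd _ (hv α hα ⟨hH, fun heq => hle ?_⟩)
  rw [Set.mem_singleton_iff.1 heq, hH₀]

end IsAdapted

/-- The members of `A`, different from `X`, that restrict to the hyperplane `Y` of `X`. -/
def CentralArrangement.fiber (A : CentralArrangement K V) (X : Submodule K V)
    (Y : Submodule K X) : Finset (Submodule K V) :=
  open Classical in (A.delete X).finite.toFinset.filter fun H => H.comap X.subtype = Y

/-- The product of the linear forms that define the members `Y` of the restriction, with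
multiplicities one less than the number of members of `A` that restrict to `Y`. -/
def CentralArrangement.restrictionPoly (A : CentralArrangement K V) (X : Submodule K V)
    (b₀ : Module.Basis (Fin n) K X) : MvPolynomial (Fin n) K :=
  ∏ Y ∈ (A.restrict X).finite.toFinset,
    linPoly b₀ (definingForm Y) ^ ((A.fiber X Y).card - 1)

theorem not_ker_le_ker_of_ne {α β : Module.Dual K V} (hα : α ≠ 0) (hβ : β ≠ 0)
    (h : LinearMap.ker β ≠ LinearMap.ker α) : ¬ LinearMap.ker α ≤ LinearMap.ker β := by
  intro hle
  obtain ⟨v, hv⟩ : ∃ v, α v = 1 := LinearMap.surjective hα 1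
  have h2 : β = β v • α := by
    ext x
    have h3 : x - α x • v ∈ LinearMap.ker α := by simp [hv]
    have h4 := hle h3
    rw [LinearMap.mem_ker, map_sub, map_smul, sub_eq_zero] at h4
    simp [h4, mul_comm]
  refine h ?_
  have h5 : β v ≠ 0 := fun h0 => hβ (by rw [h2, h0, zero_smul])
  rw [h2, LinearMap.ker_smul _ _ h5]

theorem CentralArrangement.not_le_of_mem_delete {A : CentralArrangement K V} {H₀ H : Submodule K V}
    (h₀ : H₀ ∈ A.hyperplanes) (hH : H ∈ (A.delete H₀).hyperplanes) : ¬ H₀ ≤ H := by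
  obtain ⟨α, hα, rfl⟩ := A.isHyperplane _ h₀
  obtain ⟨β, hβ, rfl⟩ := A.isHyperplane _ hH.1
  exact not_ker_le_ker_of_ne hα hβ hH.2

theorem CentralArrangement.mem_restrict_iff {A : CentralArrangement K V} {H₀ : Submodule K V}
    (h₀ : H₀ ∈ A.hyperplanes) (Y : Submodule K H₀) :
    Y ∈ (A.restrict H₀).hyperplanes ↔
      ∃ H ∈ (A.delete H₀).hyperplanes, H.comap H₀.subtype = Y := by
  constructor
  · rintro ⟨H, hH, hle, rfl⟩
    exact ⟨H, ⟨hH, fun h => hle (Set.mem_singleton_iff.1 h).ge⟩, rfl⟩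
  · rintro ⟨H, hH, rfl⟩
    exact ⟨H, hH.1, CentralArrangement.not_le_of_mem_delete h₀ hH, rfl⟩

/-- The members of the deletion are counted by their traces. Fibres over members of the restriction
are non-empty, so the truncated subtraction is harmless; the sum is the degree of `restrictionPoly`.
-/
theorem CentralArrangement.sum_card_fiber {A : CentralArrangement K V} {H₀ : Submodule K V}
    (h₀ : H₀ ∈ A.hyperplanes) :
    ∑ Y ∈ (A.restrict H₀).finite.toFinset, ((A.fiber H₀ Y).card - 1) +
      (A.restrict H₀).hyperplanes.ncard = (A.delete H₀).hyperplanes.ncard := by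
  classical
  rw [Set.ncard_eq_toFinset_card _ (A.restrict H₀).finite,
    Set.ncard_eq_toFinset_card _ (A.delete H₀).finite, Finset.card_eq_sum_ones,
    ← Finset.sum_add_distrib]
  rw [Finset.card_eq_sum_card_fiberwise (f := fun H => H.comap H₀.subtype)
    (t := (A.restrict H₀).finite.toFinset)]
  · refine Finset.sum_congr rfl fun Y hY => ?_
    obtain ⟨H, hH, hHY⟩ := (CentralArrangement.mem_restrict_iff h₀ Y).1 (by simpa using hY)
    have : 0 < (A.fiber H₀ Y).card := Finset.card_pos.2 ⟨H, by simp [fiber, hH, hHY]⟩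
    rw [Nat.sub_add_cancel this]
    simp only [fiber]
  · intro H hH
    simp only [Set.Finite.coe_toFinset] at hH ⊢
    exact (CentralArrangement.mem_restrict_iff h₀ _).2 ⟨H, hH, rfl⟩

theorem CentralArrangement.isHomogeneous_restrictionPoly (A : CentralArrangement K V)
    (X : Submodule K V) (b₀ : Module.Basis (Fin n) K X) :
    (A.restrictionPoly X b₀).IsHomogeneous
      (∑ Y ∈ (A.restrict X).finite.toFinset, ((A.fiber X Y).card - 1)) :=
  IsHomogeneous.prod _ _ _ fun Y _ => by
    simpa using (isHomogeneous_linPoly b₀ (definingForm Y)).pow ((A.fiber X Y).card - 1)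

/-- Fix a member with form α₁ and trace Y, and let P = α₁ θ(α₀) - α₀ θ(α₁). All hyperplanes with
trace Y divide P, so setting α₀ = 0 shows that the form of Y to the power of the fibre size divides
a scalar multiple of itself times θ(α₀). One factor cancels. -/
theorem IsAdapted.pow_dvd_evalZero (h : IsAdapted α₀ b b₀) {A : CentralArrangement K V}
    (h₀ : LinearMap.ker α₀ ∈ A.hyperplanes)
    {v : Fin (n + 1) → MvPolynomial (Fin (n + 1)) K}
    (hv : (A.delete (LinearMap.ker α₀)).IsLog b v)
    {Y : Submodule K (LinearMap.ker α₀)}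
    (hY : Y ∈ (A.restrict (LinearMap.ker α₀)).hyperplanes) :
    linPoly b₀ (definingForm Y) ^ ((A.fiber (LinearMap.ker α₀) Y).card - 1) ∣
      evalZero K n (v 0) := by
  classical
  set F := A.fiber (LinearMap.ker α₀) Y with hF
  have hmem : ∀ H ∈ F, H ∈ (A.delete (LinearMap.ker α₀)).hyperplanes ∧
      H.comap (LinearMap.ker α₀).subtype = Y := by
    intro H hH
    simpa [hF, CentralArrangement.fiber] using hH
  obtain ⟨H₁, hH₁, hH₁Y⟩ := (CentralArrangement.mem_restrict_iff h₀ Y).1 hY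
  have hcard : 0 < F.card := Finset.card_pos.2 ⟨H₁, by simp [hF, CentralArrangement.fiber, hH₁, hH₁Y]⟩
  obtain ⟨hβ, hβY⟩ := definingForm_spec hY
  set β := definingForm Y with hβdef
  have hres : ∀ H, H ∈ (A.delete (LinearMap.ker α₀)).hyperplanes →
      H.comap (LinearMap.ker α₀).subtype = Y → ∃ c : K, c ≠ 0 ∧
        definingForm H ∘ₗ (LinearMap.ker α₀).subtype = c • β := by
    intro H hH hHY
    obtain ⟨h1, h2⟩ := definingForm_spec hH
    have hker : LinearMap.ker (definingForm H ∘ₗ (LinearMap.ker α₀).subtype) = Y := by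
      rw [LinearMap.ker_comp, ← h2, hHY]
    refine exists_eq_smul_of_ker_eq hβ (fun h0 => ?_) (by rw [hker, ← hβY])
    rw [h0, LinearMap.ker_zero, hβY, eq_comm, LinearMap.ker_eq_top] at hker
    exact hβ hker
  set α₁ := definingForm H₁ with hα₁
  obtain ⟨c₁, hc₁, h₁⟩ := hres H₁ hH₁ hH₁Y
  set P := linPoly b α₁ * v 0 - X 0 * applyForm b α₁ v with hP
  have hdvd : ∏ H ∈ F, linPoly b (definingForm H) ∣ P := by
    refine Finset.prod_dvd_of_isRelPrime (fun H hH H' hH' hne => ?_) fun H hH => ?_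
    · exact (A.delete (LinearMap.ker α₀)).pairwise_isRelPrime b (by simpa using (hmem H hH).1)
        (by simpa using (hmem H' hH').1) hne
    · obtain ⟨hH1, hH2⟩ := hmem H hH
      obtain ⟨c, hc, h2⟩ := hres H hH1 hH2
      obtain ⟨u, hu, h3⟩ : ∃ u : K, u ≠ 0 ∧ definingForm H ∘ₗ (LinearMap.ker α₀).subtype =
          u • (α₁ ∘ₗ (LinearMap.ker α₀).subtype) :=
        ⟨c / c₁, div_ne_zero hc hc₁, by rw [h₁, h2, smul_smul, div_mul_cancel₀ _ hc₁]⟩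
      -- Forms that agree on ker α₀ differ by a multiple of α₀. Replacing u α₁ by the form of H
      -- changes P only by the factor u, since the α₀-terms cancel; the resulting expression is
      -- visibly divisible by that form.
      obtain ⟨t, ht⟩ : ∃ t : K, u • α₁ = definingForm H - t • α₀ := by
        refine ⟨definingForm H (b 0) - u * α₁ (b 0), b.ext fun i => Fin.cases ?_ (fun j => ?_) i⟩
        · simp [h.apply_zero]
        · have h4 := LinearMap.congr_fun h3 (b₀ j)
          simp only [LinearMap.comp_apply, Submodule.subtype_apply, LinearMap.smul_apply] at h4
          rw [h.succ, LinearMap.smul_apply, ← h4]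
          simp [LinearMap.mem_ker.1 (b₀ j).2]
      have hunit : IsUnit (C u : MvPolynomial (Fin (n + 1)) K) := (isUnit_iff_ne_zero.2 hu).map C
      have h5 : C u * linPoly b α₁ = linPoly b (definingForm H) - C t * X 0 := by
        rw [← linPoly_smul, ht, ← h.linPoly_eq, ← linPoly_smul, eq_sub_iff_add_eq, ← linPoly_add,
          sub_add_cancel]
      have h6 : C u * applyForm b α₁ v = applyForm b (definingForm H) v - C t * v 0 := by
        rw [← applyForm_smul_left, ht, ← h.applyForm_eq v, ← applyForm_smul_left]
        simp [applyForm, sub_mul, Finset.sum_sub_distrib]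
      have h7 : C u * P = linPoly b (definingForm H) * v 0 -
          X 0 * applyForm b (definingForm H) v := by
        linear_combination (v 0) * h5 - X 0 * h6
      obtain ⟨h8, h9⟩ := definingForm_spec hH1
      refine hunit.dvd_mul_left.1 ?_
      rw [h7]
      exact dvd_sub (dvd_mul_right _ _) ((hv _ h8 (h9 ▸ hH1)).mul_left _)
  have hdvd2 := map_dvd (evalZero K n) hdvd
  rw [map_prod, hP, map_sub, map_mul, map_mul, evalZero_X_zero, zero_mul, sub_zero,
    h.evalZero_linPoly, h₁, linPoly_smul] at hdvd2
  have hpow : linPoly b₀ β ^ F.card ∣ ∏ H ∈ F, evalZero K n (linPoly b (definingForm H)) := by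
    rw [← Finset.prod_const]
    refine Finset.prod_dvd_prod_of_dvd _ _ fun H hH => ?_
    obtain ⟨c, hc, h2⟩ := hres H (hmem H hH).1 (hmem H hH).2
    rw [h.evalZero_linPoly, h2, linPoly_smul]
    exact dvd_mul_left _ _
  have h10 := hpow.trans hdvd2
  have hunit : IsUnit (C c₁ : MvPolynomial (Fin n) K) := (isUnit_iff_ne_zero.2 hc₁).map C
  rw [mul_assoc, hunit.dvd_mul_left, ← Nat.sub_add_cancel hcard, pow_succ'] at h10
  exact (mul_dvd_mul_iff_left (linPoly_ne_zero b₀ hβ)).1 h10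

theorem IsAdapted.restrictionPoly_dvd (h : IsAdapted α₀ b b₀) {A : CentralArrangement K V}
    (h₀ : LinearMap.ker α₀ ∈ A.hyperplanes)
    {v : Fin (n + 1) → MvPolynomial (Fin (n + 1)) K}
    (hv : (A.delete (LinearMap.ker α₀)).IsLog b v) :
    A.restrictionPoly (LinearMap.ker α₀) b₀ ∣ evalZero K n (v 0) := by
  refine Finset.prod_dvd_of_isRelPrime (fun Y hY Y' hY' hne => ?_) fun Y hY => ?_
  · exact ((A.restrict (LinearMap.ker α₀)).pairwise_isRelPrime b₀ hY hY' hne).pow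
  · exact h.pow_dvd_evalZero h₀ hv (by simpa using hY)

end RestrictionToHyperplane

/-! ### The addition theorem -/

section Addition

variable {K : Type*} [Field K] {V : Type*} [AddCommGroup V] [Module K V] {n : ℕ}

theorem CentralArrangement.isLog_of_delete {A : CentralArrangement K V} {α₀ : Module.Dual K V}
    (hα₀ : α₀ ≠ 0) {b : Module.Basis (Fin n) K V} {v : Fin n → MvPolynomial (Fin n) K}
    (hv : (A.delete (LinearMap.ker α₀)).IsLog b v) (h0 : linPoly b α₀ ∣ applyForm b α₀ v) :
    A.IsLog b v := by
  intro α hα hA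
  by_cases hker : LinearMap.ker α = LinearMap.ker α₀
  · obtain ⟨c, hc, rfl⟩ := exists_eq_smul_of_ker_eq hα₀ hα hker.symm
    rw [linPoly_smul, applyForm_smul_left]
    exact mul_dvd_mul_left _ h0
  · exact hv α hα ⟨hA, hker⟩

theorem countP_map_univ {ι : Type*} [Fintype ι] (e : ι → ℕ) (d : ℕ) :
    (Finset.univ.val.map e).countP (· ≤ d) = (Finset.univ.filter fun i => e i ≤ d).card := by
  rw [Multiset.countP_map]
  rfl

theorem map_update_univ {ι : Type*} [Fintype ι] [DecidableEq ι] (e : ι → ℕ) (i : ι) (k : ℕ)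
    {E : Multiset ℕ} (h : e i ::ₘ E = Finset.univ.val.map e) :
    k ::ₘ E = Finset.univ.val.map (Function.update e i k) := by
  have h1 : (Finset.univ : Finset ι).val = i ::ₘ Finset.univ.val.erase i :=
    (Multiset.cons_erase (Finset.mem_univ_val i)).symm
  have h2 : i ∉ (Finset.univ : Finset ι).val.erase i := by
    rw [(Finset.univ : Finset ι).nodup.mem_erase_iff]
    simp
  rw [h1, Multiset.map_cons, Multiset.cons_inj_right] at h
  rw [h1, Multiset.map_cons, Function.update_self, Multiset.cons_inj_right, h]
  refine Multiset.map_congr rfl fun j hj => ?_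
  rw [Function.update_of_ne]
  rintro rfl
  exact h2 hj

/-- Among the basis derivations of the deletion there is one of the degree by which the
exponents of deletion and restriction differ that does not restrict to the hyperplane. -/
theorem IsAdapted.exists_evalZero_ne_zero {α₀ : Module.Dual K V}
    {b : Module.Basis (Fin (n + 1)) K V} {b₀ : Module.Basis (Fin n) K (LinearMap.ker α₀)}
    (h : IsAdapted α₀ b b₀) {A : CentralArrangement K V}
    (h₀ : LinearMap.ker α₀ ∈ A.hyperplanes)
    {M : Matrix (Fin (n + 1)) (Fin (n + 1)) (MvPolynomial (Fin (n + 1)) K)} {e : Fin (n + 1) → ℕ}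
    (hM : ∀ i, (A.delete (LinearMap.ker α₀)).IsLog b (M i))
    (hh : ∀ i j, (M i j).IsHomogeneous (e i)) (hd : M.det ≠ 0)
    (he : ∑ i, e i = (A.delete (LinearMap.ker α₀)).hyperplanes.ncard)
    {k : ℕ} {E : Multiset ℕ} (hE : k ::ₘ E = Finset.univ.val.map e)
    (hres : (A.restrict (LinearMap.ker α₀)).SaitoExponents b₀ E)
    (hlt : ∀ i, e i < k → evalZero K n (M i 0) = 0) :
    ∃ i, e i = k ∧ evalZero K n (M i 0) ≠ 0 := by
  classical
  obtain ⟨N, f, hN, hNh, hNd, hf, rfl⟩ := hres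
  by_contra! hcon
  have h0 : ∀ i, e i ≤ k → evalZero K n (M i 0) = 0 := fun i hi =>
    hi.lt_or_eq.elim (hlt i) (hcon i)
  -- The determinant is a scalar multiple of the defining polynomial of the deletion, none of whose
  -- factors vanishes on ker α₀.
  have hdet : (evalZero K n M.det) ≠ 0 := by
    obtain ⟨c, hc, hdet⟩ := det_eq_C_mul_definingPoly hM hh hd he
    rw [hdet, map_mul, evalZero_C, CentralArrangement.definingPoly, map_prod]
    refine mul_ne_zero (by simpa using hc) (Finset.prod_ne_zero_iff.2 fun H hH => ?_)
    rw [Set.Finite.mem_toFinset] at hH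
    obtain ⟨h1, h2⟩ := definingForm_spec hH
    rw [h.evalZero_linPoly]
    refine linPoly_ne_zero b₀ fun h3 => ?_
    refine CentralArrangement.not_le_of_mem_delete h₀ hH fun x hx => ?_
    rw [h2]
    exact LinearMap.congr_fun h3 ⟨x, hx⟩
  have hli : LinearIndependent (MvPolynomial (Fin n) K)
      fun i => (M.map (evalZero K n)).row i := by
    refine Matrix.linearIndependent_rows_of_det_ne_zero (A := M.map (evalZero K n)) ?_
    rwa [AlgHom.map_det] at hdet
  -- For rows of degree at most k the entry in column 0 vanishes after restriction, so the remaining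
  -- entries alone are already independent.
  have hli2 : LinearIndependent (MvPolynomial (Fin n) K)
      fun (i : {i // e i ≤ k}) (j : Fin n) => evalZero K n (M i j.succ) := by
    have h1 : LinearIndependent (MvPolynomial (Fin n) K)
        fun i : {i // e i ≤ k} => (M.map (evalZero K n)).row i :=
      hli.comp _ Subtype.val_injective
    refine LinearIndependent.of_comp ((LinearMap.pi fun j => Fin.cases 0 LinearMap.proj j) :
      (Fin n → MvPolynomial (Fin n) K) →ₗ[MvPolynomial (Fin n) K]
        (Fin (n + 1) → MvPolynomial (Fin n) K)) ?_
    have h2 : ((LinearMap.pi fun j => Fin.cases 0 LinearMap.proj j) :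
        (Fin n → MvPolynomial (Fin n) K) →ₗ[MvPolynomial (Fin n) K]
          (Fin (n + 1) → MvPolynomial (Fin n) K)) ∘
        (fun (i : {i // e i ≤ k}) (j : Fin n) => evalZero K n (M i j.succ)) =
        fun i : {i // e i ≤ k} => (M.map (evalZero K n)).row i := by
      ext1 i
      ext1 j
      refine Fin.cases ?_ (fun j => ?_) j
      · simp [Matrix.row, h0 i i.2]
      · simp [Matrix.row]
    rw [h2]
    exact h1
  have hcount := card_le_of_linearIndependent hNh hli2 (f := fun i => e i)
    (fun i j => isHomogeneous_evalZero (hh i j.succ)) (fun i => i.2)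
    fun i => exists_vecMul_eq_of_isLog hN hNh hNd hf
      (h.isLog_restrict rfl (hM i) (h0 i i.2))
  -- The contradiction: k ::ₘ E has one more entry of size at most k than E.
  rw [Fintype.card_subtype, ← countP_map_univ, ← countP_map_univ, ← hE] at hcount
  simp at hcount

/-- The addition theorem. -/
theorem CentralArrangement.HasSaitoExponents.addition
    {A : CentralArrangement K V} {H : Submodule K V} (hH : H ∈ A.hyperplanes) {k : ℕ} {E : Multiset ℕ}
    (hdel : (A.delete H).HasSaitoExponents (k ::ₘ E)) (hres : (A.restrict H).HasSaitoExponents E) :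
    A.HasSaitoExponents ((k + 1) ::ₘ E) := by
  classical
  obtain ⟨α₀, hα₀, rfl⟩ := A.isHyperplane H hH
  obtain ⟨n, b₀, hres⟩ := hres
  obtain ⟨b, h⟩ := exists_isAdapted hα₀ b₀
  obtain ⟨M, e, hM, hh, hd, he, hE⟩ := hdel.saitoExponents b
  set B := A.restrictionPoly (LinearMap.ker α₀) b₀ with hB
  have hBdvd : ∀ i, B ∣ evalZero K n (M i 0) := fun i => h.restrictionPoly_dvd hH (hM i)
  -- The degree of B is the difference of the sizes of deletion and restriction; these are the sums
  -- of k ::ₘ E and of E.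
  have hBh : B.IsHomogeneous k := by
    have h1 := A.isHomogeneous_restrictionPoly (LinearMap.ker α₀) b₀
    have h2 := CentralArrangement.sum_card_fiber hH
    obtain ⟨N, f, -, -, -, hf, rfl⟩ := hres
    have h3 := congrArg Multiset.sum hE
    rw [Multiset.sum_cons] at h3
    change k + ∑ i, f i = ∑ i, e i at h3
    rw [hf, he] at h3
    convert h1 using 1
    omega
  have hlt : ∀ i, e i < k → evalZero K n (M i 0) = 0 := by
    intro i hi
    obtain ⟨r, -, h1, h2⟩ := exists_isHomogeneous_of_dvd hBh
      (isHomogeneous_evalZero (hh i 0)) (hBdvd i)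
    rw [h1, h2 hi, zero_mul]
  -- The pivot row i₀: modulo α₀ its value at α₀ has the degree of B and is divisible by B, hence is
  -- a non-zero scalar times B. Multiples of it can clear the values of all other rows at α₀.
  obtain ⟨i₀, hi₀, hne⟩ := h.exists_evalZero_ne_zero hH hM hh hd he hE hres hlt
  obtain ⟨c, hc, hcB⟩ := exists_eq_C_mul_of_dvd hBh
    (hi₀ ▸ isHomogeneous_evalZero (hh i₀ 0)) (hBdvd i₀) hne
  have hq : ∀ i, ∃ q : MvPolynomial (Fin (n + 1)) K, q.IsHomogeneous (e i - k) ∧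
      evalZero K n (M i 0 + q * M i₀ 0) = 0 ∧ (e i < k → q = 0) := by
    intro i
    obtain ⟨r, h1, h2, h3⟩ := exists_isHomogeneous_of_dvd hBh
      (isHomogeneous_evalZero (hh i 0)) (hBdvd i)
    refine ⟨C (-c⁻¹) * rename Fin.succ r, (h1.rename_isHomogeneous).C_mul _, ?_, fun hi => by
      rw [h3 hi, map_zero, mul_zero]⟩
    rw [map_add, map_mul, map_mul, evalZero_rename, evalZero_C, h2, hcB]
    have : C c⁻¹ * C c = (1 : MvPolynomial (Fin n) K) := by
      rw [← C_mul, inv_mul_cancel₀ hc, C_1]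
    rw [C_neg]
    linear_combination (-(r * B)) * this
  choose q hqh hq0 hqlt using hq
  set q' : Fin (n + 1) → MvPolynomial (Fin (n + 1)) K := Function.update q i₀ 0 with hq'
  set M₁ : Matrix (Fin (n + 1)) (Fin (n + 1)) (MvPolynomial (Fin (n + 1)) K) :=
    Matrix.of fun i => M i + q' i • M i₀ with hM₁
  have hdet₁ : M₁.det = M.det :=
    Matrix.det_eq_of_forall_row_eq_smul_add_const q' i₀ (by simp [hq']) fun i j => by simp [hM₁]
  have hrow : ∀ i, i ≠ i₀ → M₁ i = M i + q i • M i₀ := fun i hi => by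
    change M i + q' i • M i₀ = _
    rw [hq', Function.update_of_ne hi]
  have hrow₀ : M₁ i₀ = M i₀ := by
    change M i₀ + q' i₀ • M i₀ = _
    rw [hq', Function.update_self, zero_smul, add_zero]
  have hi₀log : A.IsLog b ((X 0 : MvPolynomial (Fin (n + 1)) K) • M i₀) := by
    refine CentralArrangement.isLog_of_delete hα₀ ((hM i₀).smul _) ?_
    rw [applyForm_smul_right, h.linPoly_eq]
    exact dvd_mul_right _ _
  -- The cleared rows keep their degrees and are logarithmic for A. The pivot becomes so after
  -- multiplication by α₀, which is X 0 here; this raises its degree by one.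
  refine ⟨n + 1, b, M₁.updateRow i₀ ((X 0 : MvPolynomial (Fin (n + 1)) K) • M₁ i₀),
    Function.update e i₀ (k + 1), fun i => ?_, fun i j => ?_, ?_, ?_, ?_⟩
  · by_cases hi : i = i₀
    · subst hi
      rw [Matrix.updateRow_self, hrow₀]
      exact hi₀log
    · rw [Matrix.updateRow_ne hi, hrow i hi]
      refine CentralArrangement.isLog_of_delete hα₀ ((hM i).add ((hM i₀).smul _)) ?_
      rw [h.linPoly_eq, h.applyForm_eq, ← evalZero_eq_zero_iff]
      exact hq0 i
  · by_cases hi : i = i₀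
    · subst hi
      rw [Matrix.updateRow_self, hrow₀, Function.update_self]
      have h1 := (isHomogeneous_X K 0).mul (hh i j)
      rwa [hi₀, add_comm 1 k] at h1
    · rw [Matrix.updateRow_ne hi, hrow i hi, Function.update_of_ne hi]
      refine (hh i j).add ?_
      change (q i * M i₀ j).IsHomogeneous (e i)
      by_cases hik : e i < k
      · rw [hqlt i hik, zero_mul]
        exact isHomogeneous_zero _ _ _
      · have := (hqh i).mul (hh i₀ j)
        rwa [hi₀, Nat.sub_add_cancel (not_lt.1 hik)] at this
  · rw [Matrix.det_updateRow_smul, Matrix.updateRow_eq_self, hdet₁]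
    exact mul_ne_zero (X_ne_zero 0) hd
  · rw [Finset.sum_update_of_mem (Finset.mem_univ i₀)]
    have h1 := Finset.add_sum_erase Finset.univ e (Finset.mem_univ i₀)
    rw [he, hi₀, Finset.erase_eq] at h1
    have h2 : (A.delete (LinearMap.ker α₀)).hyperplanes.ncard + 1 = A.hyperplanes.ncard :=
      Set.ncard_sdiff_singleton_add_one hH A.finite
    omega
  · exact map_update_univ e i₀ (k + 1) (hi₀.symm ▸ hE)

end Addition

/-! ### Transport along linear isomorphisms -/

section Transport

variable {K : Type*} [Field K]

theorem CentralArrangement.ext_hyperplanes {V : Type*} [AddCommGroup V] [Module K V]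
    {A B : CentralArrangement K V} (h : A.hyperplanes = B.hyperplanes) : A = B := by
  cases A
  cases B
  simp only at h
  subst h
  rfl

/-- The linear isomorphism `e` maps the hyperplanes of `A` onto the hyperplanes of `B`. -/
def IsArrangementEquiv {V W : Type*} [AddCommGroup V] [Module K V] [AddCommGroup W] [Module K W]
    (e : V ≃ₗ[K] W) (A : CentralArrangement K V) (B : CentralArrangement K W) : Prop :=
  ∀ H : Submodule K W, H ∈ B.hyperplanes ↔ H.comap e.toLinearMap ∈ A.hyperplanes

section ArrangementEquiv

variable {V W : Type*} [AddCommGroup V] [Module K V] [AddCommGroup W] [Module K W]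
  {e : V ≃ₗ[K] W} {A : CentralArrangement K V} {B : CentralArrangement K W}

theorem IsArrangementEquiv.isLog_iff (h : IsArrangementEquiv e A B) {n : ℕ}
    (b : Module.Basis (Fin n) K V) (v : Fin n → MvPolynomial (Fin n) K) :
    B.IsLog (b.map e) v ↔ A.IsLog b v := by
  constructor
  · intro hv α hα hA
    have h1 : α = (α ∘ₗ e.symm.toLinearMap) ∘ₗ e.toLinearMap := by
      ext x
      simp
    have h2 := hv (α ∘ₗ e.symm.toLinearMap) (fun h0 => hα (by rw [h1, h0, LinearMap.zero_comp]))
      ((h _).2 (by rwa [← LinearMap.ker_comp, ← h1]))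
    simpa [linPoly, applyForm] using h2
  · intro hv α hα hB
    have h2 := hv (α ∘ₗ e.toLinearMap) (fun h0 => hα (by
      ext x
      have := LinearMap.congr_fun h0 (e.symm x)
      simpa using this)) (by rw [LinearMap.ker_comp]; exact (h _).1 hB)
    simpa [linPoly, applyForm] using h2

theorem IsArrangementEquiv.hasExponents (h : IsArrangementEquiv e A B) {E : Multiset ℕ}
    (hE : A.HasExponents E) : B.HasExponents E := by
  obtain ⟨n, b, θ, d, hθ, rfl⟩ := hE
  have heq : A.derivations b = B.derivations (b.map e) := by
    ext η
    rw [A.mem_derivations_iff, B.mem_derivations_iff, h.isLog_iff]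
  refine ⟨n, b.map e, θ.map (LinearEquiv.ofEq _ _ heq), d, fun i => ?_, rfl⟩
  rw [Module.Basis.map_apply, LinearEquiv.coe_ofEq_apply]
  exact hθ i

theorem IsArrangementEquiv.delete (h : IsArrangementEquiv e A B) (H : Submodule K V) :
    IsArrangementEquiv e (A.delete H) (B.delete (H.map e.toLinearMap)) := by
  intro G
  change G ∈ B.hyperplanes ∧ G ≠ _ ↔ G.comap e.toLinearMap ∈ A.hyperplanes ∧ _ ≠ H
  rw [h G]
  refine and_congr_right fun _ => not_congr ⟨?_, ?_⟩
  · rintro rfl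
    exact Submodule.comap_map_eq_of_injective e.injective H
  · rintro rfl
    exact (Submodule.map_comap_eq_of_surjective e.surjective G).symm

theorem IsArrangementEquiv.restrict (h : IsArrangementEquiv e A B) (H : Submodule K V) :
    IsArrangementEquiv (e.submoduleMap H) (A.restrict H) (B.restrict (H.map e.toLinearMap)) := by
  intro Y
  constructor
  · rintro ⟨G, hG, hle, rfl⟩
    refine ⟨G.comap e.toLinearMap, (h G).1 hG, fun hl => hle (Submodule.map_le_iff_le_comap.2 hl),
      ?_⟩
    ext x
    simp
  · rintro ⟨G, hG, hle, hY⟩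
    have h1 : (G.map e.toLinearMap).comap e.toLinearMap = G :=
      Submodule.comap_map_eq_of_injective e.injective G
    refine ⟨G.map e.toLinearMap, (h _).2 (by rwa [h1]), fun hl => hle ?_, ?_⟩
    · rwa [Submodule.map_le_iff_le_comap, h1] at hl
    · ext y
      obtain ⟨x, rfl⟩ := (e.submoduleMap H).surjective y
      have h2 := SetLike.ext_iff.1 hY x
      rw [Submodule.mem_comap] at h2
      refine h2.trans ?_
      rw [Submodule.mem_comap, Submodule.mem_comap]
      conv_lhs => rw [← h1]
      rfl

end ArrangementEquiv

theorem InductivelyFree.of_equiv {V W : Type u} [AddCommGroup V] [Module K V] [AddCommGroup W]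
    [Module K W] {A : CentralArrangement K V} (hA : InductivelyFree K V A)
    {e : V ≃ₗ[K] W} {B : CentralArrangement K W} (h : IsArrangementEquiv e A B) :
    InductivelyFree K W B := by
  induction hA generalizing W with
  | empty V A hA =>
    have : FiniteDimensional K W := e.finiteDimensional
    refine InductivelyFree.empty W B (Set.eq_empty_iff_forall_notMem.2 fun H hH => ?_)
    have := (h H).1 hH
    rw [hA] at this
    exact this
  | add V A H hH hdel hres E' E'' hE' hE'' hle ih₁ ih₂ =>
    refine InductivelyFree.add W B (H.map e.toLinearMap) ((h _).2 ?_) (ih₁ (h.delete H))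
      (ih₂ (h.restrict H)) E' E'' ((h.delete H).hasExponents hE')
      ((h.restrict H).hasExponents hE'') hle
    rwa [Submodule.comap_map_eq_of_injective e.injective H]

variable {V : Type*} [AddCommGroup V] [Module K V]

theorem isArrangementEquiv_restrict_top (A : CentralArrangement K V) :
    IsArrangementEquiv Submodule.topEquiv.symm A (A.restrict ⊤) := by
  intro Y
  constructor
  · rintro ⟨H, hH, -, rfl⟩
    exact hH
  · intro hY
    refine ⟨_, hY, fun hle => ?_, ?_⟩
    · obtain ⟨α, hα, h⟩ := A.isHyperplane _ hY
      rw [h, top_le_iff, LinearMap.ker_eq_top] at hle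
      exact hα hle
    · ext x
      rfl

/-- A flag found inside H consists of subspaces of H, whereas flats of A are subspaces of V; this
identification carries freeness and inductive freeness from one to the other. -/
theorem isArrangementEquiv_restrict_restrict (A : CentralArrangement K V) (H : Submodule K V)
    (X : Submodule K H) :
    IsArrangementEquiv (Submodule.equivMapOfInjective H.subtype H.injective_subtype X)
      ((A.restrict H).restrict X) (A.restrict (X.map H.subtype)) := by
  intro Y
  constructor
  · rintro ⟨G, hG, hle, rfl⟩
    refine ⟨G.comap H.subtype, ⟨G, hG, fun hl => hle ?_, rfl⟩, fun hl => hle ?_, ?_⟩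
    · exact (Submodule.map_subtype_le H X).trans hl
    · exact Submodule.map_le_iff_le_comap.2 hl
    · ext x
      simp
  · rintro ⟨_, ⟨G, hG, -, rfl⟩, hle, hY⟩
    refine ⟨G, hG, fun hl => hle (Submodule.map_le_iff_le_comap.1 hl), ?_⟩
    ext y
    obtain ⟨x, rfl⟩ := (Submodule.equivMapOfInjective H.subtype H.injective_subtype X).surjective y
    have h2 := SetLike.ext_iff.1 hY x
    rw [Submodule.mem_comap] at h2
    exact h2

end Transport

/-! ### Flags of flats -/

section Flags

variable {K : Type*} [Field K] {V : Type u} [AddCommGroup V] [Module K V]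

/-- There is a flag of flats of all positive dimensions, the restrictions to which are inductively
free with exponents given by the initial segments of `l`. -/
def CentralArrangement.HasFlag (A : CentralArrangement K V) (l : List ℕ) : Prop :=
  ∃ X : ℕ → Submodule K V,
    (∀ d, 1 ≤ d → d ≤ Module.finrank K V → A.IsFlat (X d) ∧ Module.finrank K (X d) = d ∧
      (A.restrict (X d)).HasExponents (l.take d : Multiset ℕ) ∧
      InductivelyFree K (X d) (A.restrict (X d))) ∧
    ∀ d, 1 ≤ d → d + 1 ≤ Module.finrank K V → X d ≤ X (d + 1)

theorem CentralArrangement.hasFlag_of_finrank_eq_zero (A : CentralArrangement K V) (l : List ℕ)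
    (h : Module.finrank K V = 0) : A.HasFlag l :=
  ⟨fun _ => ⊤, fun d h1 h2 => by omega, fun d h1 h2 => by omega⟩

/-- The hyperplanes cutting out X are lifted to members of A, and H itself is added to the
intersection. -/
theorem CentralArrangement.IsFlat.map_subtype {A : CentralArrangement K V} {H : Submodule K V}
    (hH : H ∈ A.hyperplanes) {X : Submodule K H} (hX : (A.restrict H).IsFlat X) :
    A.IsFlat (X.map H.subtype) := by
  obtain ⟨B, hB, rfl⟩ := hX
  refine ⟨{H} ∪ {G ∈ A.hyperplanes | G.comap H.subtype ∈ B}, ?_, ?_⟩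
  · rintro G (rfl | hG)
    · exact hH
    · exact hG.1
  · ext x
    simp only [Submodule.mem_map, Submodule.mem_sInf, Submodule.subtype_apply]
    constructor
    · rintro ⟨y, hy, rfl⟩ G (rfl | hG)
      · exact y.2
      · exact hy _ hG.2
    · intro h
      have hxH : x ∈ H := h H (Or.inl rfl)
      refine ⟨⟨x, hxH⟩, fun Y hY => ?_, rfl⟩
      obtain ⟨G, hG, -, rfl⟩ := hB hY
      exact h G (Or.inr ⟨hG, hY⟩)

/-- The flag inside H is completed by V. Appending `a` at the end makes the shorter initial segments
those of `l`. -/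
theorem CentralArrangement.HasFlag.of_restrict {A : CentralArrangement K V} {H : Submodule K V}
    (hH : H ∈ A.hyperplanes) {l : List ℕ} {a : ℕ} (hl : l.length = Module.finrank K H)
    (hdim : Module.finrank K V = Module.finrank K H + 1)
    (hA : InductivelyFree K V A) (hE : A.HasExponents ((l ++ [a] : List ℕ) : Multiset ℕ))
    (h : (A.restrict H).HasFlag l) : A.HasFlag (l ++ [a]) := by
  obtain ⟨X, hX, hle⟩ := h
  obtain ⟨X', hX₁, hX₂⟩ : ∃ X' : ℕ → Submodule K V,
      (∀ d, d ≤ Module.finrank K H → X' d = (X d).map H.subtype) ∧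
      ∀ d, ¬ d ≤ Module.finrank K H → X' d = ⊤ :=
    ⟨fun d => if d ≤ Module.finrank K H then (X d).map H.subtype else ⊤,
      fun d hd => if_pos hd, fun d hd => if_neg hd⟩
  refine ⟨X', fun d h1 h2 => ?_, fun d h1 h2 => ?_⟩
  · by_cases hd : d ≤ Module.finrank K H
    · obtain ⟨h3, h4, h5, h6⟩ := hX d h1 hd
      have he := isArrangementEquiv_restrict_restrict A H (X d)
      rw [hX₁ d hd, List.take_append_of_le_length (hl ▸ hd)]
      exact ⟨h3.map_subtype hH, by rw [Submodule.finrank_map_subtype_eq, h4], he.hasExponents h5,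
        h6.of_equiv he⟩
    · have he := isArrangementEquiv_restrict_top A
      rw [hX₂ d hd, List.take_of_length_le (by simp; omega)]
      exact ⟨⟨∅, Set.empty_subset _, sInf_empty.symm⟩, by rw [finrank_top]; omega,
        he.hasExponents hE, hA.of_equiv he⟩
  · by_cases hd : d + 1 ≤ Module.finrank K H
    · rw [hX₁ _ hd, hX₁ d (by omega)]
      exact Submodule.map_mono (hle d h1 hd)
    · rw [hX₂ _ hd]
      exact le_top

theorem CentralArrangement.HasFlag.indFlagAccurate {A : CentralArrangement K V} {l : List ℕ}
    (h : A.HasFlag l) (hl : l.Pairwise (· ≤ ·)) (hA : InductivelyFree K V A)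
    (hE : A.HasExponents (l : Multiset ℕ)) : A.IndFlagAccurate := by
  obtain ⟨X, hX, hle⟩ := h
  have hw : A.IsFlagWitness X :=
    ⟨⟨l, hl, hE, fun d h1 h2 => ⟨(hX d h1 h2).1, (hX d h1 h2).2.1, (hX d h1 h2).2.2.1⟩⟩, hle⟩
  exact ⟨hA, ⟨X, hw⟩, X, hw, fun d h1 h2 => (hX d h1 h2).2.2.2⟩

end Flags

/-! ### Modular extensions -/

section ModularExtension

variable {K : Type*} [Field K] {V : Type u} [AddCommGroup V] [Module K V]

/-- `A` is inductively free, and `E` is its multiset of exponents. -/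
def CentralArrangement.IsIndFree (A : CentralArrangement K V) (E : Multiset ℕ) : Prop :=
  InductivelyFree K V A ∧ A.HasSaitoExponents E

theorem CentralArrangement.IsIndFree.addition {A : CentralArrangement K V} {H : Submodule K V}
    (hH : H ∈ A.hyperplanes) {k : ℕ} {E : Multiset ℕ} (hdel : (A.delete H).IsIndFree (k ::ₘ E))
    (hres : (A.restrict H).IsIndFree E) : A.IsIndFree ((k + 1) ::ₘ E) :=
  ⟨InductivelyFree.add V A H hH hdel.1 hres.1 _ _ hdel.2.hasExponents hres.2.hasExponents
    (Multiset.le_cons_self E k), CentralArrangement.HasSaitoExponents.addition hH hdel.2 hres.2⟩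

theorem CentralArrangement.isIndFree_empty [FiniteDimensional K V] {A : CentralArrangement K V}
    (hA : A.hyperplanes = ∅) : A.IsIndFree (Multiset.replicate (Module.finrank K V) 0) := by
  refine ⟨InductivelyFree.empty V A hA, _, Module.finBasis K V, 1, 0, fun i α _ hα => ?_,
    fun i j => ?_, ?_, ?_, ?_⟩
  · rw [hA] at hα
    exact hα.elim
  · rw [Matrix.one_apply]
    split_ifs
    · exact MvPolynomial.isHomogeneous_one _ _
    · exact MvPolynomial.isHomogeneous_zero _ _ _
  · rw [Matrix.det_one]
    exact one_ne_zero
  · simp [hA]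
  · simp [Multiset.map_const']

/-- On ker (y - a) the forms y - a' and a - a' coincide, and the hyperplane of a - a' already
belongs to A₀. So the other new hyperplanes leave no new trace. -/
theorem restrict_eq_of_modular {A₀ A : CentralArrangement K V} {y : Module.Dual K V}
    {L : Finset (Module.Dual K V)}
    (hA : A.hyperplanes = A₀.hyperplanes ∪ {H | ∃ a ∈ L, H = LinearMap.ker (y - a)})
    (hL : ∀ a ∈ L, ∀ a' ∈ L, a ≠ a' → LinearMap.ker (a - a') ∈ A₀.hyperplanes)
    {a : Module.Dual K V} (ha : a ∈ L) (hy : LinearMap.ker (y - a) ∉ A₀.hyperplanes) :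
    A.restrict (LinearMap.ker (y - a)) = A₀.restrict (LinearMap.ker (y - a)) := by
  have hmem : LinearMap.ker (y - a) ∈ A.hyperplanes := by
    rw [hA]
    exact Or.inr ⟨a, ha, rfl⟩
  refine CentralArrangement.ext_hyperplanes (Set.ext fun Y => ⟨?_, ?_⟩)
  · rintro ⟨H, hH, hle, rfl⟩
    rw [hA] at hH
    rcases hH with hH | ⟨a', ha', rfl⟩
    · exact ⟨H, hH, hle, rfl⟩
    · have hne : a ≠ a' := by
        rintro rfl
        exact hle le_rfl
      have hG := hL a ha a' ha' hne
      refine ⟨_, hG, CentralArrangement.not_le_of_mem_delete hmem ⟨hA ▸ Or.inl hG, fun h => hy ?_⟩,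
        ?_⟩
      · rwa [← Set.mem_singleton_iff.1 h]
      · ext x
        have hx : y x = a x := by
          have := x.2
          rwa [LinearMap.mem_ker, LinearMap.sub_apply, sub_eq_zero] at this
        simp [hx]
  · rintro ⟨H, hH, hle, rfl⟩
    exact ⟨H, hA ▸ Or.inl hH, hle, rfl⟩

/-- The new hyperplanes are added in any order: at each stage the restriction is that of A₀, with
exponents E, so every addition raises the same exponent by one. -/
theorem CentralArrangement.IsIndFree.modular_extension {A₀ : CentralArrangement K V}
    {y : Module.Dual K V} {L : Finset (Module.Dual K V)}
    (hL : ∀ a ∈ L, ∀ a' ∈ L, a ≠ a' → LinearMap.ker (a - a') ∈ A₀.hyperplanes)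
    (hy : ∀ a ∈ L, LinearMap.ker (y - a) ∉ A₀.hyperplanes)
    {k : ℕ} {E : Multiset ℕ} (h₀ : A₀.IsIndFree (k ::ₘ E))
    (hr : ∀ a ∈ L, (A₀.restrict (LinearMap.ker (y - a))).IsIndFree E)
    {A : CentralArrangement K V}
    (hA : A.hyperplanes = A₀.hyperplanes ∪ {H | ∃ a ∈ L, H = LinearMap.ker (y - a)}) :
    A.IsIndFree ((k + L.card) ::ₘ E) := by
  classical
  induction L using Finset.induction_on generalizing A with
  | empty =>
    rw [CentralArrangement.ext_hyperplanes (A := A) (B := A₀) (by rw [hA]; simp)]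
    exact h₀
  | insert a L ha ih =>
    have hmem : LinearMap.ker (y - a) ∈ A.hyperplanes := by
      rw [hA]
      exact Or.inr ⟨a, Finset.mem_insert_self a L, rfl⟩
    rw [Finset.card_insert_of_notMem ha, ← add_assoc]
    refine CentralArrangement.IsIndFree.addition hmem ?_ ?_
    · refine ih (fun a ha a' ha' => hL a (Finset.mem_insert_of_mem ha) a'
        (Finset.mem_insert_of_mem ha')) (fun a ha => hy a (Finset.mem_insert_of_mem ha))
        (fun a ha => hr a (Finset.mem_insert_of_mem ha)) (Set.ext fun H => ⟨?_, ?_⟩)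
      · rintro ⟨hH, hne⟩
        rw [hA] at hH
        rcases hH with hH | ⟨a', ha', rfl⟩
        · exact Or.inl hH
        · refine Or.inr ⟨a', (Finset.mem_insert.1 ha').resolve_left ?_, rfl⟩
          rintro rfl
          exact hne rfl
      · rintro (hH | ⟨a', ha', rfl⟩)
        · refine ⟨hA ▸ Or.inl hH, fun h => hy a (Finset.mem_insert_self a L) ?_⟩
          rwa [← Set.mem_singleton_iff.1 h]
        · refine ⟨hA ▸ Or.inr ⟨a', Finset.mem_insert_of_mem ha', rfl⟩, fun h => ?_⟩
          -- Different elements of L give different hyperplanes: if ker (y - a) = ker (y - a'), this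
          -- hyperplane would lie in the kernel of a - a', a member of A₀ different from it.
          have hne : a ≠ a' := fun h => ha (h ▸ ha')
          have hG := hL a (Finset.mem_insert_self a L) a' (Finset.mem_insert_of_mem ha') hne
          refine CentralArrangement.not_le_of_mem_delete hmem
            ⟨by rw [hA]; exact Or.inl hG, fun h' => hy a (Finset.mem_insert_self a L) ?_⟩ fun x hx => ?_
          · rwa [← Set.mem_singleton_iff.1 h']
          · have hx' := hx
            rw [← Set.mem_singleton_iff.1 h] at hx'
            rw [LinearMap.mem_ker, LinearMap.sub_apply, sub_eq_zero] at hx hx' ⊢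
            rw [← hx, hx']
    · rw [restrict_eq_of_modular hA hL (Finset.mem_insert_self a L)
        (hy a (Finset.mem_insert_self a L))]
      exact hr a (Finset.mem_insert_self a L)

end ModularExtension

/-! ### Arrangements presented by linear forms -/

section Presentations

variable {K : Type*} [Field K] {V : Type*} [AddCommGroup V] [Module K V]

/-- `A` consists of the kernels of the non-zero linear forms with the property `P`. -/
def CentralArrangement.IsPresentedBy (A : CentralArrangement K V)
    (P : Module.Dual K V → Prop) : Prop :=
  ∀ H, H ∈ A.hyperplanes ↔ ∃ φ, P φ ∧ φ ≠ 0 ∧ H = LinearMap.ker φ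

/-- Proportional forms have the same kernel. The scalar may be any u because the zero form is
excluded from a presentation; this lets degenerate forms disappear on restriction. -/
theorem CentralArrangement.IsPresentedBy.congr {A : CentralArrangement K V}
    {P P' : Module.Dual K V → Prop} (h : A.IsPresentedBy P)
    (h₁ : ∀ φ, P φ → φ ≠ 0 → ∃ φ', P' φ' ∧ ∃ u : K, φ = u • φ')
    (h₂ : ∀ φ', P' φ' → φ' ≠ 0 → ∃ φ, P φ ∧ ∃ u : K, φ' = u • φ) : A.IsPresentedBy P' := by
  intro H
  rw [h H]
  constructor
  · rintro ⟨φ, hφ, hne, rfl⟩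
    obtain ⟨φ', hφ', u, rfl⟩ := h₁ φ hφ hne
    obtain ⟨hu, hne'⟩ := smul_ne_zero_iff.1 hne
    exact ⟨φ', hφ', hne', LinearMap.ker_smul _ _ hu⟩
  · rintro ⟨φ, hφ, hne, rfl⟩
    obtain ⟨φ', hφ', u, rfl⟩ := h₂ φ hφ hne
    obtain ⟨hu, hne'⟩ := smul_ne_zero_iff.1 hne
    exact ⟨φ', hφ', hne', LinearMap.ker_smul _ _ hu⟩

theorem CentralArrangement.IsPresentedBy.restrict {A : CentralArrangement K V}
    {P : Module.Dual K V → Prop} (h : A.IsPresentedBy P) (X : Submodule K V) :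
    (A.restrict X).IsPresentedBy fun φ => ∃ φ', P φ' ∧ φ = φ' ∘ₗ X.subtype := by
  intro Y
  constructor
  · rintro ⟨H, hH, hle, rfl⟩
    obtain ⟨φ, hφ, hne, rfl⟩ := (h H).1 hH
    exact ⟨_, ⟨φ, hφ, rfl⟩, fun h0 => hle fun x hx => LinearMap.congr_fun h0 ⟨x, hx⟩,
      (LinearMap.ker_comp _ _).symm⟩
  · rintro ⟨_, ⟨φ, hφ, rfl⟩, hne, rfl⟩
    refine ⟨LinearMap.ker φ, (h _).2 ⟨φ, hφ, fun h0 => hne (by rw [h0, LinearMap.zero_comp]), rfl⟩,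
      fun hle => hne ?_, LinearMap.ker_comp _ _⟩
    ext x
    exact hle x.2

theorem CentralArrangement.IsPresentedBy.delete {A : CentralArrangement K V}
    {P P' : Module.Dual K V → Prop} (h : A.IsPresentedBy P) {φ₀ : Module.Dual K V}
    (h₁ : ∀ φ, P φ ↔ P' φ ∨ φ = φ₀)
    (h₂ : ∀ φ, P' φ → φ ≠ 0 → LinearMap.ker φ ≠ LinearMap.ker φ₀) :
    (A.delete (LinearMap.ker φ₀)).IsPresentedBy P' := by
  intro H
  constructor
  · rintro ⟨hH, hne⟩
    obtain ⟨φ, hφ, h0, rfl⟩ := (h H).1 hH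
    refine ⟨φ, ((h₁ φ).1 hφ).resolve_right ?_, h0, rfl⟩
    rintro rfl
    exact hne rfl
  · rintro ⟨φ, hφ, h0, rfl⟩
    exact ⟨(h _).2 ⟨φ, (h₁ φ).2 (Or.inl hφ), h0, rfl⟩, h₂ φ hφ h0⟩

end Presentations

/-! ### Shi configurations and the addition of an edgeless vertex -/

section ShiForms

variable {V : Type u} [AddCommGroup V] [Module ℝ V]

/-- The linear forms of the cone over the arrangement that consists of `x_i = x_j` for `i, j ∈ S`,
of `x_i - x_j = 1` for `i < j` in `T`, and of `x_i = c` for `i ∈ S` and `c ∈ ψ i`; the form `z`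
defines the hyperplane at infinity. -/
inductive ShiForm (S T : Finset ℕ) (ψ : ℕ → Finset ℤ) (x : ℕ → Module.Dual ℝ V)
    (z : Module.Dual ℝ V) : Module.Dual ℝ V → Prop
  | infinity : ShiForm S T ψ x z z
  | braid (i j : ℕ) (hi : i ∈ S) (hj : j ∈ S) : ShiForm S T ψ x z (x i - x j)
  | shi (i j : ℕ) (hi : i ∈ T) (hj : j ∈ T) (hij : i < j) : ShiForm S T ψ x z (x i - x j - z)
  | level (i : ℕ) (c : ℤ) (hi : i ∈ S) (hc : c ∈ ψ i) : ShiForm S T ψ x z (x i - (c : ℝ) • z)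

/-- The linear forms `z` and `x_i`, `i ∈ S`, are linearly independent. -/
def IndepCoords (S : Finset ℕ) (x : ℕ → Module.Dual ℝ V) (z : Module.Dual ℝ V) : Prop :=
  ∀ (a : ℕ → ℝ) (w : ℝ), ∃ v, z v = w ∧ ∀ i ∈ S, x i v = a i

variable {S T : Finset ℕ} {ψ : ℕ → Finset ℤ} {x : ℕ → Module.Dual ℝ V} {z : Module.Dual ℝ V}

theorem IndepCoords.mono {S' : Finset ℕ} (h : IndepCoords S x z) (hS : S' ⊆ S) :
    IndepCoords S' x z := fun a w => by
  obtain ⟨v, hv, hx⟩ := h a w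
  exact ⟨v, hv, fun i hi => hx i (hS hi)⟩

theorem IndepCoords.z_ne_zero (h : IndepCoords S x z) : z ≠ 0 := by
  rintro rfl
  obtain ⟨v, hv, -⟩ := h 0 1
  simp at hv

theorem ShiForm.congr {ψ' : ℕ → Finset ℤ} (h : ∀ i ∈ S, ψ i = ψ' i) {φ : Module.Dual ℝ V}
    (hφ : ShiForm S T ψ x z φ) : ShiForm S T ψ' x z φ := by
  cases hφ with
  | infinity => exact .infinity
  | braid i j hi hj => exact .braid i j hi hj
  | shi i j hi hj hij => exact .shi i j hi hj hij
  | level i c hi hc => exact .level i c hi (h i hi ▸ hc)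

theorem ShiForm.comp {W : Type u} [AddCommGroup W] [Module ℝ W] (f : W →ₗ[ℝ] V)
    {φ : Module.Dual ℝ W} :
    ShiForm S T ψ (fun i => x i ∘ₗ f) (z ∘ₗ f) φ ↔ ∃ φ', ShiForm S T ψ x z φ' ∧ φ = φ' ∘ₗ f := by
  constructor
  · intro h
    cases h with
    | infinity => exact ⟨_, .infinity, rfl⟩
    | braid i j hi hj => exact ⟨_, .braid i j hi hj, rfl⟩
    | shi i j hi hj hij => exact ⟨_, .shi i j hi hj hij, rfl⟩
    | level i c hi hc => exact ⟨_, .level i c hi hc, rfl⟩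
  · rintro ⟨φ', h, rfl⟩
    cases h with
    | infinity => exact .infinity
    | braid i j hi hj => exact .braid i j hi hj
    | shi i j hi hj hij => exact .shi i j hi hj hij
    | level i c hi hc => exact .level i c hi hc

theorem CentralArrangement.IsPresentedBy.restrict_shiForm {A : CentralArrangement ℝ V}
    (h : A.IsPresentedBy (ShiForm S T ψ x z)) (X : Submodule ℝ V) :
    (A.restrict X).IsPresentedBy
      (ShiForm S T ψ (fun i => x i ∘ₗ X.subtype) (z ∘ₗ X.subtype)) := by
  intro Y
  rw [h.restrict X Y]
  simp only [ShiForm.comp]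

/-- Every arrangement presented by the forms of `ShiForm S T ψ` is inductively free with exponents
`l`, up to additional zeros if the coordinates do not span the dual space, and has a flag as in the
definition of flag-accuracy if they do. -/
def IsAccurateConfig (S T : Finset ℕ) (ψ : ℕ → Finset ℤ) (l : List ℕ) : Prop :=
  ∀ (V : Type u) [AddCommGroup V] [Module ℝ V] [FiniteDimensional ℝ V]
    (A : CentralArrangement ℝ V) (x : ℕ → Module.Dual ℝ V) (z : Module.Dual ℝ V) (k : ℕ),
    IndepCoords S x z → A.IsPresentedBy (ShiForm S T ψ x z) →
    Module.finrank ℝ V = S.card + 1 + k →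
    A.IsIndFree ((l : Multiset ℕ) + Multiset.replicate k 0) ∧ (k = 0 → A.HasFlag l)

theorem IsAccurateConfig.congr {ψ' : ℕ → Finset ℤ} {l : List ℕ}
    (h : IsAccurateConfig.{u} S T ψ l) (hψ : ∀ i ∈ S, ψ i = ψ' i) :
    IsAccurateConfig.{u} S T ψ' l := by
  intro V _ _ _ A x z k hI hA hd
  refine h V A x z k hI (fun H => (hA H).trans ⟨?_, ?_⟩) hd
  · rintro ⟨φ, hφ, h2⟩
    exact ⟨φ, hφ.congr fun i hi => (hψ i hi).symm, h2⟩
  · rintro ⟨φ, hφ, h2⟩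
    exact ⟨φ, hφ.congr hψ, h2⟩

theorem finrank_ker_add_one [FiniteDimensional ℝ V] {φ : Module.Dual ℝ V} (h : φ ≠ 0) :
    Module.finrank ℝ (LinearMap.ker φ) + 1 = Module.finrank ℝ V :=
  Module.Dual.finrank_ker_add_one_of_ne_zero h

theorem isAccurateConfig_empty (ψ : ℕ → Finset ℤ) : IsAccurateConfig.{u} ∅ ∅ ψ [1] := by
  intro V _ _ _ A x z k hI hA hd
  have hz := hI.z_ne_zero
  have hmem : LinearMap.ker z ∈ A.hyperplanes := (hA _).2 ⟨z, .infinity, hz, rfl⟩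
  have hall : ∀ H ∈ A.hyperplanes, H = LinearMap.ker z := by
    intro H hH
    obtain ⟨φ, hφ, -, rfl⟩ := (hA H).1 hH
    cases hφ with
    | infinity => rfl
    | braid i j hi hj => simp at hi
    | shi i j hi hj hij => simp at hi
    | level i c hi hc => simp at hi
  have hker := finrank_ker_add_one hz
  simp only [Finset.card_empty, zero_add] at hd
  have hdel : (A.delete (LinearMap.ker z)).hyperplanes = ∅ :=
    Set.eq_empty_iff_forall_notMem.2 fun H hH => hH.2 (hall H hH.1)
  have hres : (A.restrict (LinearMap.ker z)).hyperplanes = ∅ :=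
    Set.eq_empty_iff_forall_notMem.2 fun Y ⟨H, hH, hle, _⟩ => hle (hall H hH).ge
  have h1 := CentralArrangement.isIndFree_empty hdel
  have h2 := CentralArrangement.isIndFree_empty hres
  -- The empty deletion has k + 1 exponents 0, one of which is raised to 1 by adding z = 0.
  rw [hd, add_comm, Multiset.replicate_succ] at h1
  rw [show Module.finrank ℝ (LinearMap.ker z) = k by omega] at h2
  have h3 := h1.addition hmem h2
  refine ⟨h3, ?_⟩
  rintro rfl
  exact CentralArrangement.HasFlag.of_restrict (l := []) hmem (by simp; omega) (by omega) h3.1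
    h3.2.hasExponents (CentralArrangement.hasFlag_of_finrank_eq_zero _ _ (by omega))

theorem cons_add_eq (l : List ℕ) (a : ℕ) (R : Multiset ℕ) :
    a ::ₘ ((l : Multiset ℕ) + R) = ((l ++ [a] : List ℕ) : Multiset ℕ) + R := by
  rw [← Multiset.cons_add, ← Multiset.coe_add, Multiset.coe_singleton, add_comm (l : Multiset ℕ),
    Multiset.singleton_add]

/-- Adding a vertex `r` that is the end of no edge and whose levels are levels of all other
vertices is a modular extension. -/
theorem IsAccurateConfig.insert_vertex {r : ℕ} (hr : r ∈ S) (hrT : r ∉ T) (hT : T ⊆ S)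
    (hψ : ∀ i ∈ S, ψ r ⊆ ψ i) (hne : (ψ r).Nonempty) {l : List ℕ} (hl : l.length = S.card)
    (h : IsAccurateConfig.{u} (S.erase r) T ψ l) :
    IsAccurateConfig.{u} S T ψ (l ++ [(ψ r).card + (S.erase r).card]) := by
  classical
  intro V _ _ _ A x z k hI hA hd
  have hcard : (S.erase r).card + 1 = S.card := Finset.card_erase_add_one hr
  have hsub : ∀ φ, ShiForm (S.erase r) T ψ x z φ → ShiForm S T ψ x z φ := by
    intro φ hφ
    cases hφ with
    | infinity => exact .infinity
    | braid i j hi hj => exact .braid i j (Finset.mem_of_mem_erase hi) (Finset.mem_of_mem_erase hj)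
    | shi i j hi hj hij => exact .shi i j hi hj hij
    | level i c hi hc => exact .level i c (Finset.mem_of_mem_erase hi) hc
  let A₀ : CentralArrangement ℝ V :=
    { hyperplanes := {H | ∃ φ, ShiForm (S.erase r) T ψ x z φ ∧ φ ≠ 0 ∧ H = LinearMap.ker φ}
      finite := A.finite.subset fun H ⟨φ, h1, h2⟩ => (hA H).2 ⟨φ, hsub φ h1, h2⟩
      isHyperplane := fun H ⟨φ, _, h2⟩ => ⟨φ, h2⟩ }
  have hA₀ : A₀.IsPresentedBy (ShiForm (S.erase r) T ψ x z) := fun H => Iff.rfl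
  -- As r is the end of no edge, the forms involving x_r are, up to sign, the x_r - a with a in L:
  -- its levels and its differences with the other vertices.
  let L : Finset (Module.Dual ℝ V) :=
    (ψ r).image (fun c : ℤ => (c : ℝ) • z) ∪ (S.erase r).image x
  have hLmem : ∀ a, a ∈ L ↔ (∃ c ∈ ψ r, (c : ℝ) • z = a) ∨ ∃ i ∈ S.erase r, x i = a := by
    intro a
    simp [L]
  have hLcard : L.card = (ψ r).card + (S.erase r).card := by
    rw [Finset.card_union_of_disjoint, Finset.card_image_of_injOn, Finset.card_image_of_injOn]
    · intro i hi j hj hij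
      by_contra hne
      obtain ⟨v, -, hv⟩ := hI (fun m => if m = i then 1 else 0) 0
      have h1 := hv i (Finset.mem_of_mem_erase hi)
      have h2 := hv j (Finset.mem_of_mem_erase hj)
      rw [show x i = x j from hij] at h1
      rw [h1, if_pos rfl, if_neg (Ne.symm hne)] at h2
      exact one_ne_zero h2
    · intro c _ c' _ hcc
      obtain ⟨v, hv, -⟩ := hI 0 1
      have := LinearMap.congr_fun hcc v
      simpa [hv] using this
    · rw [Finset.disjoint_left]
      intro a h1 h2
      simp only [Finset.mem_image] at h1 h2
      obtain ⟨c, -, rfl⟩ := h1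
      obtain ⟨i, hi, h3⟩ := h2
      obtain ⟨v, hv, hx⟩ := hI 1 0
      have := LinearMap.congr_fun h3 v
      rw [hx i (Finset.mem_of_mem_erase hi)] at this
      simp [hv] at this
  -- Modularity: two levels differ by a multiple of z, two vertices by a braid form, and a vertex
  -- and a level of r by a level form of that vertex. The last case uses that levels of r are levels
  -- of all vertices.
  have hLdiff : ∀ a ∈ L, ∀ a' ∈ L, a ≠ a' → LinearMap.ker (a - a') ∈ A₀.hyperplanes := by
    intro a ha a' ha' hne
    rcases (hLmem a).1 ha with ⟨c, hc, rfl⟩ | ⟨i, hi, rfl⟩ <;>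
      rcases (hLmem a').1 ha' with ⟨c', hc', rfl⟩ | ⟨i', hi', rfl⟩
    · refine ⟨z, .infinity, hI.z_ne_zero, ?_⟩
      have h1 : (c : ℝ) • z - (c' : ℝ) • z = ((c : ℝ) - c') • z := by
        ext v
        simp [sub_mul]
      rw [h1, LinearMap.ker_smul]
      exact fun h0 => hne (by rw [sub_eq_zero.1 h0])
    · refine ⟨_, .level i' c hi' (hψ i' (Finset.mem_of_mem_erase hi') hc),
        sub_ne_zero.2 (Ne.symm hne), ?_⟩
      rw [← neg_sub, LinearMap.ker_neg]
    · exact ⟨_, .level i c' hi (hψ i (Finset.mem_of_mem_erase hi) hc'), sub_ne_zero.2 hne, rfl⟩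
    · exact ⟨_, .braid i i' hi hi', sub_ne_zero.2 hne, rfl⟩
  have hy : ∀ a ∈ L, LinearMap.ker (x r - a) ∉ A₀.hyperplanes := by
    rintro a ha ⟨φ, hφ, -, hker⟩
    -- The vector dual to x_r is killed by all forms of A₀ but by no x_r - a.
    obtain ⟨u, hu, hx⟩ := hI (fun m => if m = r then 1 else 0) 0
    have hxr : x r u = 1 := by simpa using hx r hr
    have hx0 : ∀ i ∈ S.erase r, x i u = 0 := fun i hi => by
      have := hx i (Finset.mem_of_mem_erase hi)
      rwa [if_neg (Finset.ne_of_mem_erase hi)] at this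
    have hT0 : ∀ i ∈ T, x i u = 0 := fun i hi =>
      hx0 i (Finset.mem_erase.2 ⟨fun h => hrT (h ▸ hi), hT hi⟩)
    have h1 : u ∈ LinearMap.ker φ := by
      rw [LinearMap.mem_ker]
      cases hφ with
      | infinity => exact hu
      | braid i j hi hj => simp [hx0 i hi, hx0 j hj]
      | shi i j hi hj hij => simp [hT0 i hi, hT0 j hj, hu]
      | level i c hi hc => simp [hx0 i hi, hu]
    rw [← hker, LinearMap.mem_ker, LinearMap.sub_apply, hxr] at h1
    rcases (hLmem a).1 ha with ⟨c, hc, rfl⟩ | ⟨i, hi, rfl⟩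
    · simp [hu] at h1
    · simp [hx0 i hi] at h1
  have hAA : A.hyperplanes = A₀.hyperplanes ∪ {H | ∃ a ∈ L, H = LinearMap.ker (x r - a)} := by
    ext H
    rw [hA H]
    constructor
    · rintro ⟨φ, hφ, h0, rfl⟩
      cases hφ with
      | infinity => exact Or.inl ⟨_, .infinity, h0, rfl⟩
      | braid i j hi hj =>
        by_cases hir : i = r
        · subst hir
          refine Or.inr ⟨x j, (hLmem _).2 (Or.inr ⟨j, Finset.mem_erase.2 ⟨?_, hj⟩, rfl⟩), rfl⟩
          rintro rfl
          exact h0 (sub_self _)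
        · by_cases hjr : j = r
          · subst hjr
            refine Or.inr ⟨x i, (hLmem _).2 (Or.inr ⟨i, Finset.mem_erase.2 ⟨hir, hi⟩, rfl⟩), ?_⟩
            rw [← neg_sub, LinearMap.ker_neg]
          · exact Or.inl ⟨_, .braid i j (Finset.mem_erase.2 ⟨hir, hi⟩)
              (Finset.mem_erase.2 ⟨hjr, hj⟩), h0, rfl⟩
      | shi i j hi hj hij => exact Or.inl ⟨_, .shi i j hi hj hij, h0, rfl⟩
      | level i c hi hc =>
        by_cases hir : i = r
        · subst hir
          exact Or.inr ⟨_, (hLmem _).2 (Or.inl ⟨c, hc, rfl⟩), rfl⟩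
        · exact Or.inl ⟨_, .level i c (Finset.mem_erase.2 ⟨hir, hi⟩) hc, h0, rfl⟩
    · rintro (⟨φ, hφ, h0, rfl⟩ | ⟨a, ha, rfl⟩)
      · exact ⟨φ, hsub φ hφ, h0, rfl⟩
      · refine ⟨x r - a, ?_, fun h0 => hy a ha ?_, rfl⟩
        · rcases (hLmem a).1 ha with ⟨c, hc, rfl⟩ | ⟨i, hi, rfl⟩
          · exact .level r c hr hc
          · exact .braid r i hr (Finset.mem_of_mem_erase hi)
        · exfalso
          obtain ⟨u, hu, hx⟩ := hI (fun m => if m = r then 1 else 0) 0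
          have h1 := LinearMap.congr_fun h0 u
          rw [LinearMap.sub_apply, hx r hr, if_pos rfl, LinearMap.zero_apply] at h1
          rcases (hLmem a).1 ha with ⟨c, hc, rfl⟩ | ⟨i, hi, rfl⟩
          · simp [hu] at h1
          · rw [hx i (Finset.mem_of_mem_erase hi), if_neg (Finset.ne_of_mem_erase hi)] at h1
            simp at h1
  have hne0 : ∀ a ∈ L, x r - a ≠ 0 := by
    intro a ha
    have h1 : LinearMap.ker (x r - a) ∈ A.hyperplanes := hAA ▸ Or.inr ⟨a, ha, rfl⟩
    obtain ⟨α, hα, h2⟩ := A.isHyperplane _ h1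
    intro h0
    rw [h0, LinearMap.ker_zero, eq_comm, LinearMap.ker_eq_top] at h2
    exact hα h2
  have hres : ∀ a ∈ L, (A₀.restrict (LinearMap.ker (x r - a))).IsIndFree
      ((l : Multiset ℕ) + Multiset.replicate k 0) ∧
      (k = 0 → (A₀.restrict (LinearMap.ker (x r - a))).HasFlag l) := by
    intro a ha
    have hfr := finrank_ker_add_one (hne0 a ha)
    refine h _ _ _ _ k (fun c w => ?_) (hA₀.restrict_shiForm _) (by omega)
    -- The value of a is determined by z and the remaining coordinates, so prescribing these on ker
    -- (x_r - a) only forces the value t of x_r.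
    obtain ⟨t, ht⟩ : ∃ t : ℝ, ∀ v, z v = w → (∀ i ∈ S.erase r, x i v = c i) → a v = t := by
      rcases (hLmem a).1 ha with ⟨d, hd, rfl⟩ | ⟨i, hi, rfl⟩
      · exact ⟨d * w, fun v hv _ => by simp [hv]⟩
      · exact ⟨c i, fun v _ hv => hv i hi⟩
    obtain ⟨v, hv, hx⟩ := hI (Function.update c r t) w
    have hx' : ∀ i ∈ S.erase r, x i v = c i := fun i hi => by
      rw [hx i (Finset.mem_of_mem_erase hi), Function.update_of_ne (Finset.ne_of_mem_erase hi)]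
    refine ⟨⟨v, ?_⟩, hv, hx'⟩
    rw [LinearMap.mem_ker, LinearMap.sub_apply, hx r hr, Function.update_self, ht v hv hx', sub_self]
  -- In V the forms of A₀ leave one more dimension unused, whence the exponent 0 that the extension
  -- raises. This is why `IsAccurateConfig` admits surplus dimensions.
  have h₀ : A₀.IsIndFree (0 ::ₘ ((l : Multiset ℕ) + Multiset.replicate k 0)) := by
    have := (h V A₀ x z (k + 1) (hI.mono (Finset.erase_subset _ _)) hA₀ (by omega)).1
    rwa [Multiset.replicate_succ, Multiset.add_cons] at this
  have hind := CentralArrangement.IsIndFree.modular_extension hLdiff hy h₀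
    (fun a ha => (hres a ha).1) hAA
  have heq : (0 + L.card) ::ₘ ((l : Multiset ℕ) + Multiset.replicate k 0) =
      ((l ++ [(ψ r).card + (S.erase r).card] : List ℕ) : Multiset ℕ) + Multiset.replicate k 0 := by
    rw [zero_add, hLcard, cons_add_eq]
  rw [heq] at hind
  refine ⟨hind, ?_⟩
  rintro rfl
  obtain ⟨c, hc⟩ := hne
  have ha : (c : ℝ) • z ∈ L := (hLmem _).2 (Or.inl ⟨c, hc, rfl⟩)
  have hfr := finrank_ker_add_one (hne0 _ ha)
  refine CentralArrangement.HasFlag.of_restrict (H := LinearMap.ker (x r - (c : ℝ) • z))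
    (hAA ▸ Or.inr ⟨_, ha, rfl⟩) (by omega) (by omega) hind.1 ?_ ?_
  · simpa using hind.2.hasExponents
  · rw [restrict_eq_of_modular hAA hLdiff ha (hy _ ha)]
    exact (hres _ ha).2 rfl

end ShiForms

/-! ### The induction for complete Shi configurations -/

section ShiInduction

variable {S : Finset ℕ} {ψ ψ₀ ψ' : ℕ → Finset ℤ}

theorem ShiForm.ker_ne_ker_level {V : Type u} [AddCommGroup V] [Module ℝ V]
    {x : ℕ → Module.Dual ℝ V} {z : Module.Dual ℝ V} (hI : IndepCoords S x z) {p : ℕ} (hp : p ∈ S)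
    {c : ℤ} (hc : c ∉ ψ₀ p) {φ : Module.Dual ℝ V} (hφ : ShiForm S S ψ₀ x z φ) (h0 : φ ≠ 0) :
    LinearMap.ker φ ≠ LinearMap.ker (x p - (c : ℝ) • z) := by
  have key : ∀ v, z v = 1 → x p v = c → φ v ≠ 0 →
      LinearMap.ker φ ≠ LinearMap.ker (x p - (c : ℝ) • z) := by
    intro v h1 h2 h3 h4
    have h5 : v ∈ LinearMap.ker (x p - (c : ℝ) • z) := by simp [h1, h2]
    rw [← h4] at h5
    exact h3 h5
  -- A point of x_p = c z off the other hyperplanes: with z = 1, distinct coordinates differ by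
  -- non-zero even integers, so neither x_i = x_j nor x_i - x_j = 1 holds.
  obtain ⟨v, hv, hx⟩ := hI (fun i => ((c + 2 * ((i : ℤ) - p) : ℤ) : ℝ)) 1
  have hxp : x p v = c := by rw [hx p hp]; simp
  cases hφ with
  | infinity => exact key v hv hxp (by simp [hv])
  | braid i j hi hj =>
    refine key v hv hxp fun h => h0 ?_
    rw [LinearMap.sub_apply, hx i hi, hx j hj, ← Int.cast_sub, Int.cast_eq_zero] at h
    rw [show i = j by omega, sub_self]
  | shi i j hi hj hij =>
    refine key v hv hxp fun h => ?_
    rw [LinearMap.sub_apply, LinearMap.sub_apply, hx i hi, hx j hj, hv, ← Int.cast_sub,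
      ← Int.cast_one, ← Int.cast_sub, Int.cast_eq_zero] at h
    omega
  | level i a hi ha =>
    by_cases hip : i = p
    · subst hip
      refine key v hv hxp fun h => hc ?_
      rw [LinearMap.sub_apply, hxp, LinearMap.smul_apply, hv, smul_eq_mul, mul_one,
        ← Int.cast_sub, Int.cast_eq_zero] at h
      rwa [show c = a by omega]
    -- For a level at another vertex, a half-integral coordinate avoids all integer levels.
    · obtain ⟨w, hw, hy⟩ := hI (fun i => if i = p then (c : ℝ) else c + 1 / 2) 1
      refine key w hw (by rw [hy p hp, if_pos rfl]) fun h => ?_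
      rw [LinearMap.sub_apply, hy i hi, if_neg hip, LinearMap.smul_apply, hw, smul_eq_mul,
        mul_one] at h
      have h1 : ((2 * c + 1 - 2 * a : ℤ) : ℝ) = 0 := by
        push_cast
        linarith
      rw [Int.cast_eq_zero] at h1
      omega

/-- The forms of a Shi configuration on the hyperplane `x_p = c z`. -/
theorem CentralArrangement.IsPresentedBy.erase_vertex {V : Type u} [AddCommGroup V] [Module ℝ V]
    {A : CentralArrangement ℝ V} {x : ℕ → Module.Dual ℝ V} {z : Module.Dual ℝ V} {p : ℕ}
    (hp : p ∈ S) {c : ℤ} (hxp : x p = (c : ℝ) • z)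
    (hψ' : ∀ i ∈ S.erase p, ∀ a, a ∈ ψ' i ↔
      a ∈ ψ i ∨ a = c ∨ (i < p ∧ a = c + 1) ∨ (p < i ∧ a = c - 1))
    (hA : A.IsPresentedBy (ShiForm S S ψ x z)) :
    A.IsPresentedBy (ShiForm (S.erase p) (S.erase p) ψ' x z) := by
  have hxp' : ∀ v, x p v = c * z v := fun v => by rw [hxp]; rfl
  have hmem : ∀ {i}, i ∈ S → i ≠ p → i ∈ S.erase p := fun hi hne => Finset.mem_erase.2 ⟨hne, hi⟩
  have hlev : ∀ {i}, i ∈ S → i ≠ p → ∀ {a}, (a ∈ ψ i ∨ a = c ∨ (i < p ∧ a = c + 1) ∨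
      (p < i ∧ a = c - 1)) → ShiForm (S.erase p) (S.erase p) ψ' x z (x i - (a : ℝ) • z) :=
    fun hi hne _ ha => .level _ _ (hmem hi hne) ((hψ' _ (hmem hi hne) _).2 ha)
  refine hA.congr ?_ ?_
  · intro φ hφ h0
    cases hφ with
    | infinity => exact ⟨z, .infinity, 1, (one_smul _ _).symm⟩
    | braid i j hi hj =>
      by_cases hip : i = p
      · subst hip
        have hji : j ≠ i := by
          rintro rfl
          exact h0 (sub_self _)
        refine ⟨_, hlev hj hji (Or.inr (Or.inl rfl)), -1, ?_⟩
        ext v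
        simp [hxp']
      · by_cases hjp : j = p
        · subst hjp
          refine ⟨_, hlev hi hip (Or.inr (Or.inl rfl)), 1, ?_⟩
          ext v
          simp [hxp']
        · exact ⟨_, .braid i j (hmem hi hip) (hmem hj hjp), 1, (one_smul _ _).symm⟩
    | shi i j hi hj hij =>
      by_cases hip : i = p
      · subst hip
        refine ⟨_, hlev hj hij.ne' (Or.inr (Or.inr (Or.inr ⟨hij, rfl⟩))), -1, ?_⟩
        ext v
        simp [hxp']
        ring
      · by_cases hjp : j = p
        · subst hjp
          refine ⟨_, hlev hi hip (Or.inr (Or.inr (Or.inl ⟨hij, rfl⟩))), 1, ?_⟩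
          ext v
          simp [hxp']
          ring
        · exact ⟨_, .shi i j (hmem hi hip) (hmem hj hjp) hij, 1, (one_smul _ _).symm⟩
    | level i a hi ha =>
      by_cases hip : i = p
      · subst hip
        -- Every level of p becomes a multiple of z.
        refine ⟨z, .infinity, c - a, ?_⟩
        ext v
        simp [hxp', sub_mul]
      · exact ⟨_, hlev hi hip (Or.inl ha), 1, (one_smul _ _).symm⟩
  · intro φ hφ h0
    cases hφ with
    | infinity => exact ⟨z, .infinity, 1, (one_smul _ _).symm⟩
    | braid i j hi hj =>
      exact ⟨_, .braid i j (Finset.mem_of_mem_erase hi) (Finset.mem_of_mem_erase hj), 1,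
        (one_smul _ _).symm⟩
    | shi i j hi hj hij =>
      exact ⟨_, .shi i j (Finset.mem_of_mem_erase hi) (Finset.mem_of_mem_erase hj) hij, 1,
        (one_smul _ _).symm⟩
    | level i a hi ha =>
      have hiS := Finset.mem_of_mem_erase hi
      rcases (hψ' i hi a).1 ha with ha | rfl | ⟨hlt, rfl⟩ | ⟨hlt, rfl⟩
      · exact ⟨_, .level i a hiS ha, 1, (one_smul _ _).symm⟩
      · refine ⟨_, .braid i p hiS hp, 1, ?_⟩
        ext v
        simp [hxp']
      · refine ⟨_, .shi i p hiS hp hlt, 1, ?_⟩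
        ext v
        simp [hxp']
        ring
      · refine ⟨_, .shi p i hp hiS hlt, -1, ?_⟩
        ext v
        simp [hxp']
        ring

/-- A single addition, at the hyperplane x_p = c z. There braid forms at p turn into the level c,
and Shi forms into c + 1 below p and c - 1 above p, which is what ψ' records. -/
theorem IsAccurateConfig.insert_level {p : ℕ} (hp : p ∈ S) {c : ℤ} (hc : c ∉ ψ₀ p)
    (hψ : ∀ i ∈ S, ∀ a, a ∈ ψ i ↔ a ∈ ψ₀ i ∨ (i = p ∧ a = c))
    (hψ' : ∀ i ∈ S.erase p, ∀ a, a ∈ ψ' i ↔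
      a ∈ ψ i ∨ a = c ∨ (i < p ∧ a = c + 1) ∨ (p < i ∧ a = c - 1))
    {l₀ l : List ℕ} {a : ℕ} (hl : l.length = S.card) (hl₀ : (l₀ : Multiset ℕ) = a ::ₘ (l : Multiset ℕ))
    (h₀ : IsAccurateConfig.{u} S S ψ₀ l₀)
    (h' : IsAccurateConfig.{u} (S.erase p) (S.erase p) ψ' l) :
    IsAccurateConfig.{u} S S ψ (l ++ [a + 1]) := by
  intro V _ _ _ A x z k hI hA hd
  have hcard : (S.erase p).card + 1 = S.card := Finset.card_erase_add_one hp
  have hφ₀ : x p - (c : ℝ) • z ≠ 0 := by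
    intro h
    obtain ⟨v, hv, hx⟩ := hI (fun _ => 1) 0
    have := LinearMap.congr_fun h v
    rw [LinearMap.sub_apply, LinearMap.smul_apply, hv, hx p hp] at this
    simp at this
  have hform : ShiForm S S ψ x z (x p - (c : ℝ) • z) :=
    .level p c hp ((hψ p hp c).2 (Or.inr ⟨rfl, rfl⟩))
  have hmem : LinearMap.ker (x p - (c : ℝ) • z) ∈ A.hyperplanes := (hA _).2 ⟨_, hform, hφ₀, rfl⟩
  have hfr := finrank_ker_add_one hφ₀
  have hdelP : (A.delete (LinearMap.ker (x p - (c : ℝ) • z))).IsPresentedBy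
      (ShiForm S S ψ₀ x z) := by
    refine hA.delete (fun φ => ⟨fun hφ => ?_, ?_⟩) fun φ hφ h0 => hφ.ker_ne_ker_level hI hp hc h0
    · cases hφ with
      | infinity => exact Or.inl .infinity
      | braid i j hi hj => exact Or.inl (.braid i j hi hj)
      | shi i j hi hj hij => exact Or.inl (.shi i j hi hj hij)
      | level i b hi hb =>
        rcases (hψ i hi b).1 hb with hb | ⟨rfl, rfl⟩
        · exact Or.inl (.level i b hi hb)
        · exact Or.inr rfl
    · rintro (hφ | rfl)
      · cases hφ with
        | infinity => exact .infinity
        | braid i j hi hj => exact .braid i j hi hj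
        | shi i j hi hj hij => exact .shi i j hi hj hij
        | level i b hi hb => exact .level i b hi ((hψ i hi b).2 (Or.inl hb))
      · exact hform
  have hxp : x p ∘ₗ (LinearMap.ker (x p - (c : ℝ) • z)).subtype =
      (c : ℝ) • (z ∘ₗ (LinearMap.ker (x p - (c : ℝ) • z)).subtype) := by
    ext v
    have := v.2
    rw [LinearMap.mem_ker, LinearMap.sub_apply, sub_eq_zero] at this
    exact this
  have hresP := (hA.restrict_shiForm (LinearMap.ker (x p - (c : ℝ) • z))).erase_vertex hp hxp hψ'
  have hresI : IndepCoords (S.erase p)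
      (fun i => x i ∘ₗ (LinearMap.ker (x p - (c : ℝ) • z)).subtype)
      (z ∘ₗ (LinearMap.ker (x p - (c : ℝ) • z)).subtype) := by
    intro b w
    obtain ⟨v, hv, hx⟩ := hI (Function.update b p (c * w)) w
    refine ⟨⟨v, ?_⟩, hv, fun i hi => ?_⟩
    · rw [LinearMap.mem_ker, LinearMap.sub_apply, hx p hp, Function.update_self,
        LinearMap.smul_apply, hv, smul_eq_mul, sub_self]
    · refine (hx i (Finset.mem_of_mem_erase hi)).trans ?_
      rw [Function.update_of_ne (Finset.ne_of_mem_erase hi)]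
  obtain ⟨h1, -⟩ := h₀ V _ x z k hI hdelP hd
  obtain ⟨h2, h3⟩ := h' _ _ _ _ k hresI hresP (by omega)
  rw [hl₀, Multiset.cons_add] at h1
  have h4 := h1.addition hmem h2
  rw [cons_add_eq] at h4
  refine ⟨h4, ?_⟩
  rintro rfl
  exact CentralArrangement.HasFlag.of_restrict hmem (by omega) (by omega) h4.1
    (by simpa using h4.2.hasExponents) (h3 rfl)

/-- With a single level, a change of coordinates turns the first vertex into a
vertex that is the end of no edge. -/
theorem IsAccurateConfig.change_root {p : ℕ} (hp : p ∈ S) (hmin : ∀ i ∈ S, p ≤ i) {c : ℤ}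
    (hψ : ∀ i ∈ S, ψ i = {c}) {l : List ℕ}
    (h : IsAccurateConfig.{u} S (S.erase p) (fun i => if i = p then {0} else {-1, 0}) l) :
    IsAccurateConfig.{u} S S ψ l := by
  intro V _ _ _ A x z k hI hA hd
  -- With these coordinates, braid forms and levels exchange roles at p: x_i - x_p is the level 0 of
  -- i, while x_i - c z becomes y_i - y_p. As p is least, its Shi forms become the level -1 of the
  -- other vertices, and p has no edge left.
  obtain ⟨y, hyp, hy⟩ : ∃ y : ℕ → Module.Dual ℝ V, y p = (c : ℝ) • z - x p ∧
      ∀ i, i ≠ p → y i = x i - x p :=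
    ⟨fun i => if i = p then (c : ℝ) • z - x p else x i - x p, if_pos rfl, fun i hi => if_neg hi⟩
  have hmem : ∀ {i}, i ∈ S → i ≠ p → i ∈ S.erase p := fun hi hne => Finset.mem_erase.2 ⟨hne, hi⟩
  refine h V A y z k (fun a w => ?_) (hA.congr ?_ ?_) hd
  · obtain ⟨v, hv, hx⟩ := hI (fun i => if i = p then c * w - a p else a i + (c * w - a p)) w
    have hxp := hx p hp
    rw [if_pos rfl] at hxp
    refine ⟨v, hv, fun i hi => ?_⟩
    by_cases hip : i = p
    · subst hip
      simp [hyp, hv, hxp]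
    · rw [hy i hip, LinearMap.sub_apply, hxp, hx i hi, if_neg hip, add_sub_cancel_right]
  · intro φ hφ h0
    cases hφ with
    | infinity => exact ⟨z, .infinity, 1, (one_smul _ _).symm⟩
    | braid i j hi hj =>
      by_cases hip : i = p
      · subst hip
        have hji : j ≠ i := by
          rintro rfl
          exact h0 (sub_self _)
        refine ⟨_, .level j 0 hj (by simp [hji]), -1, ?_⟩
        ext v
        simp [hy j hji]
      · by_cases hjp : j = p
        · subst hjp
          refine ⟨_, .level i 0 hi (by simp [hip]), 1, ?_⟩
          simp [hy i hip]
        · refine ⟨_, .braid i j hi hj, 1, ?_⟩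
          simp [hy i hip, hy j hjp]
    | shi i j hi hj hij =>
      have hjp : j ≠ p := fun h => by
        have := hmin i hi
        omega
      by_cases hip : i = p
      · subst hip
        refine ⟨_, .level j (-1) hj (by simp [hjp]), -1, ?_⟩
        ext v
        simp [hy j hjp]
        ring
      · refine ⟨_, .shi i j (hmem hi hip) (hmem hj hjp) hij, 1, ?_⟩
        simp [hy i hip, hy j hjp]
    | level i a hi ha =>
      rw [hψ i hi, Finset.mem_singleton] at ha
      subst ha
      by_cases hip : i = p
      · subst hip
        refine ⟨_, .level i 0 hi (by simp), -1, ?_⟩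
        ext v
        simp [hyp]
      · refine ⟨_, .braid i p hi hp, 1, ?_⟩
        simp [hy i hip, hyp]
  · intro φ hφ h0
    cases hφ with
    | infinity => exact ⟨z, .infinity, 1, (one_smul _ _).symm⟩
    | braid i j hi hj =>
      by_cases hip : i = p
      · subst hip
        have hji : j ≠ i := by
          rintro rfl
          exact h0 (sub_self _)
        refine ⟨_, .level j c hj (by simp [hψ j hj]), -1, ?_⟩
        ext v
        simp [hy j hji, hyp]
      · by_cases hjp : j = p
        · subst hjp
          refine ⟨_, .level i c hi (by simp [hψ i hi]), 1, ?_⟩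
          simp [hy i hip, hyp]
        · refine ⟨_, .braid i j hi hj, 1, ?_⟩
          simp [hy i hip, hy j hjp]
    | shi i j hi hj hij =>
      refine ⟨_, .shi i j (Finset.mem_of_mem_erase hi) (Finset.mem_of_mem_erase hj) hij, 1, ?_⟩
      simp [hy i (Finset.ne_of_mem_erase hi), hy j (Finset.ne_of_mem_erase hj)]
    | level i a hi ha =>
      by_cases hip : i = p
      · subst hip
        simp only [if_true, Finset.mem_singleton] at ha
        subst ha
        refine ⟨_, .level i c hi (by simp [hψ i hi]), -1, ?_⟩
        ext v
        simp [hyp]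
      · simp only [if_neg hip, Finset.mem_insert, Finset.mem_singleton] at ha
        rcases ha with rfl | rfl
        · refine ⟨_, .shi p i hp hi (lt_of_le_of_ne (hmin i hi) (Ne.symm hip)), -1, ?_⟩
          ext v
          simp [hy i hip]
          ring
        · refine ⟨_, .braid i p hi hp, 1, ?_⟩
          simp [hy i hip]

/-- The exponents `1`, `a` (`p` times) and `a + 1` (`q` times). -/
def expList (a p q : ℕ) : List ℕ := 1 :: (List.replicate p a ++ List.replicate q (a + 1))

theorem length_expList (a p q : ℕ) : (expList a p q).length = p + q + 1 := by
  simp [expList]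

theorem expList_succ_right (a p q : ℕ) : expList a p (q + 1) = expList a p q ++ [a + 1] := by
  simp [expList, List.replicate_succ']

theorem expList_succ_left (a p : ℕ) : expList a (p + 1) 0 = expList a p 0 ++ [a] := by
  simp [expList, List.replicate_succ']

theorem expList_zero_left (a q : ℕ) : expList a 0 q = expList (a + 1) q 0 := by
  simp [expList]

theorem coe_expList_succ_left (a p q : ℕ) :
    (expList a (p + 1) q : Multiset ℕ) = a ::ₘ (expList a p q : Multiset ℕ) := by
  rw [expList, expList, List.replicate_succ, Multiset.cons_coe, Multiset.coe_eq_coe,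
    List.cons_append]
  exact List.Perm.swap _ _ _

theorem pairwise_expList {a : ℕ} (ha : 1 ≤ a) (p q : ℕ) :
    (expList a p q).Pairwise (· ≤ ·) := by
  rw [expList, List.pairwise_cons, List.pairwise_append]
  refine ⟨fun b hb => ?_, List.pairwise_replicate.2 (Or.inr le_rfl),
    List.pairwise_replicate.2 (Or.inr le_rfl), fun b hb b' hb' => ?_⟩
  · rcases List.mem_append.1 hb with h | h <;> rw [List.eq_of_mem_replicate h] <;> omega
  · rw [List.eq_of_mem_replicate hb, List.eq_of_mem_replicate hb']
    omega

/-- The levels `c - N, …, c` for the vertices outside `U` and `c - N - 1, …, c` for those in `U`. -/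
def stepLevels (U : Finset ℕ) (N : ℕ) (c : ℤ) (i : ℕ) : Finset ℤ :=
  Finset.Icc (c - N - if i ∈ U then 1 else 0) c

theorem mem_stepLevels {U : Finset ℕ} {N : ℕ} {c : ℤ} {i : ℕ} {a : ℤ} :
    a ∈ stepLevels U N c i ↔ (c - N - if i ∈ U then 1 else 0) ≤ a ∧ a ≤ c :=
  Finset.mem_Icc

/-- Induction on |S|, then on N, then on |U|. The sum |S| + N is invariant under the restriction
used, which keeps the exponents of deletion and restriction compatible. -/
theorem isAccurateConfig_stepLevels (S : Finset ℕ) (N : ℕ) (c : ℤ) (U : Finset ℕ) (hU : U ⊆ S)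
    (hup : ∀ i ∈ U, ∀ j ∈ S, i < j → j ∈ U) :
    IsAccurateConfig.{u} S S (stepLevels U N c)
      (expList (S.card + N) (S.card - U.card) U.card) := by
  obtain ⟨n, hn⟩ : ∃ n, S.card = n := ⟨_, rfl⟩
  induction n generalizing S N c U with
  | zero =>
    obtain rfl := Finset.card_eq_zero.1 hn
    obtain rfl := Finset.subset_empty.1 hU
    exact isAccurateConfig_empty _
  | succ n ihn =>
    have hS : S.Nonempty := Finset.card_pos.1 (by omega)
    have hcard : ∀ {p}, p ∈ S → (S.erase p).card = n := fun hp => by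
      rw [Finset.card_erase_of_mem hp, hn, Nat.add_sub_cancel]
    have hstep : ∀ (N : ℕ) (c : ℤ),
        IsAccurateConfig.{u} S S (stepLevels ∅ N c) (expList (n + 1 + N) (n + 1) 0) →
        ∀ (q : ℕ) (U : Finset ℕ), U ⊆ S → (∀ i ∈ U, ∀ j ∈ S, i < j → j ∈ U) → U.card = q →
        IsAccurateConfig.{u} S S (stepLevels U N c) (expList (n + 1 + N) (n + 1 - q) q) := by
      intro N c h0 q
      induction q with
      | zero =>
        intro U _ _ hq
        obtain rfl := Finset.card_eq_zero.1 hq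
        exact h0
      | succ q ihq =>
        intro U hU hup hq
        have hUne : U.Nonempty := Finset.card_pos.1 (by omega)
        obtain ⟨p, hpU, hmin⟩ : ∃ p ∈ U, ∀ i ∈ U, p ≤ i :=
          ⟨U.min' hUne, U.min'_mem hUne, fun i hi => U.min'_le i hi⟩
        have hUcard : (U.erase p).card = q := by
          rw [Finset.card_erase_of_mem hpU, hq, Nat.add_sub_cancel]
        have hqn : q ≤ n := by
          have := Finset.card_le_card hU
          omega
        have hup' : ∀ i ∈ U.erase p, ∀ j ∈ S, i < j → j ∈ U.erase p := by
          intro i hi j hj hij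
          have hiU := Finset.mem_of_mem_erase hi
          have := hmin i hiU
          exact Finset.mem_erase.2 ⟨by omega, hup i hiU j hj hij⟩
        have h1 := ihq (U.erase p) ((Finset.erase_subset _ _).trans hU) hup' hUcard
        -- The restriction to x_p = (c - N - 1) z. Every vertex acquires the level c - N - 1; those
        -- above p, which are exactly the elements of U other than p, also acquire c - N - 2. The
        -- level c - N arising below p was present before.
        have h2 := ihn (S.erase p) (N + 1) c (U.erase p) (Finset.erase_subset_erase _ hU)
          (fun i hi j hj => hup' i hi j (Finset.mem_of_mem_erase hj)) (hcard (hU hpU))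
        rw [hcard (hU hpU), hUcard, show n + (N + 1) = n + 1 + N by omega] at h2
        rw [show n + 1 - q = n - q + 1 by omega] at h1
        rw [Nat.add_sub_add_right, expList_succ_right]
        refine IsAccurateConfig.insert_level (hU hpU) (c := c - N - 1) ?_ ?_ ?_ ?_
          (coe_expList_succ_left _ _ _) h1 h2
        · simp [mem_stepLevels]
        · intro i hi a
          by_cases hip : i = p
          · subst hip
            simp only [mem_stepLevels, hpU, Finset.notMem_erase, if_true, if_false, true_and]
            omega
          · simp only [mem_stepLevels, Finset.mem_erase, hip, ne_eq, not_false_eq_true, true_and,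
              false_and, or_false]
        · intro i hi a
          obtain ⟨hip, hiS⟩ := Finset.mem_erase.1 hi
          by_cases hiU : i ∈ U
          · have := hmin i hiU
            simp only [mem_stepLevels, Finset.mem_erase, hip, ne_eq, not_false_eq_true, true_and,
              hiU, if_true]
            omega
          · have : ¬ p < i := fun h => hiU (hup p hpU i hiS h)
            simp only [mem_stepLevels, Finset.mem_erase, hiU, and_false, if_false]
            omega
        · rw [length_expList, hn]
          omega
    have hempty : ∀ (N : ℕ) (c : ℤ),
        IsAccurateConfig.{u} S S (stepLevels ∅ N c) (expList (n + 1 + N) (n + 1) 0) := by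
      intro N
      induction N with
      | zero =>
        intro c
        obtain ⟨p, hpS, hmin⟩ : ∃ p ∈ S, ∀ i ∈ S, p ≤ i :=
          ⟨S.min' hS, S.min'_mem hS, fun i hi => S.min'_le i hi⟩
        -- In the new coordinates, S \ {p} carries the step configuration with levels -1 and 0, and
        -- the edgeless vertex p contributes the exponent 1 + n.
        refine IsAccurateConfig.change_root hpS hmin (c := c) (fun i _ => ?_) ?_
        · ext a
          simp [stepLevels]
        · have h1 := ihn (S.erase p) 1 0 ∅ (Finset.empty_subset _) (by simp) (hcard hpS)
          rw [hcard hpS, Finset.card_empty, Nat.sub_zero] at h1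
          have h2 := IsAccurateConfig.insert_vertex (S := S) (T := S.erase p)
            (ψ := fun i => if i = p then {0} else {-1, 0}) hpS (Finset.notMem_erase p S)
            (Finset.erase_subset _ _) (fun i hi => by
              by_cases hip : i = p <;> simp [hip]) (by simp)
            (by rw [length_expList, hn]) (h1.congr fun i hi => by
              ext a
              simp only [mem_stepLevels, if_neg (Finset.ne_of_mem_erase hi), Finset.mem_insert,
                Finset.mem_singleton, Finset.notMem_empty, if_false]
              omega)
          rw [hcard hpS] at h2
          rw [Nat.add_zero, expList_succ_left]
          simpa [add_comm] using h2
      | succ N ihN =>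
        intro c
        -- For U = S every vertex has the levels c - (N + 1), ..., c, so this is the configuration
        -- for N + 1 with U empty.
        have h1 := hstep N c (ihN c) (n + 1) S subset_rfl (fun _ _ j hj _ => hj) hn
        rw [Nat.sub_self, expList_zero_left] at h1
        refine IsAccurateConfig.congr h1 fun i hi => ?_
        ext a
        simp only [mem_stepLevels, hi, if_true, Finset.notMem_empty, if_false]
        omega
    rw [hn]
    exact hstep N c (hempty N c) U.card U hU hup rfl

end ShiInduction

/-! ### The Shi descendants and their cones -/

section ShiDescendants

/-- The levels of the Shi descendant, with vertices counted from `0`. -/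
def descendantLevels (ℓ m d p k i : ℕ) : Finset ℤ :=
  Finset.Icc (-min ((ℓ : ℤ) - i) k - m + if i < p then 1 else 0) d

theorem shiWeight_eq (ℓ m d p k : ℕ) (v : Fin ℓ) :
    shiWeight ℓ m d p k v = descendantLevels ℓ m d p k v := by
  ext a
  simp only [shiWeight, descendantLevels]
  split_ifs <;> simp only [Finset.mem_Icc] <;> omega

/-- The vertices below s span the tournament and form a step configuration. The vertices from s on
have no edges and level sets that shrink with the index, so they are adjoined in increasing order.
-/
theorem isAccurateConfig_descendantLevels {ℓ m d p k s : ℕ} (hk : 1 ≤ k)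
    (hs : s + k = ℓ + 1) (j : ℕ) (hj : j + s ≤ ℓ) :
    IsAccurateConfig.{u} (Finset.range (s + j)) (Finset.range s) (descendantLevels ℓ m d p k)
      (expList (ℓ + m + d) (min p (s + j)) (s + j - min p (s + j))) := by
  induction j with
  | zero =>
    have hcard : ((Finset.range s).filter fun i => p ≤ i).card = s - min p s := by
      have h1 : (Finset.range s).filter (fun i => p ≤ i) = Finset.Ico p s := by
        ext i
        simp only [Finset.mem_filter, Finset.mem_range, Finset.mem_Ico]
        omega
      rw [h1, Nat.card_Ico]
      omega
    -- For i < s the minimum of ℓ - i and k is k. The common levels are 1 - k - m, ..., d, which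
    -- gives N = m + (k - 1) + d, and the vertices i ≥ p have the extra level -k - m.
    have h1 := isAccurateConfig_stepLevels.{u} (Finset.range s) (m + (k - 1) + d) d
      ((Finset.range s).filter fun i => p ≤ i) (Finset.filter_subset _ _) (by
        intro i hi j hj hij
        simp only [Finset.mem_filter] at hi ⊢
        exact ⟨hj, by omega⟩)
    rw [hcard, Finset.card_range, show s + (m + (k - 1) + d) = ℓ + m + d by omega,
      show s - (s - min p s) = min p s by omega] at h1
    refine IsAccurateConfig.congr h1 fun i hi => ?_
    ext a
    rw [Finset.mem_range] at hi
    simp only [mem_stepLevels, descendantLevels, Finset.mem_Icc, Finset.mem_filter,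
      Finset.mem_range]
    split_ifs <;> omega
  | succ j ih =>
    have herase : (Finset.range (s + (j + 1))).erase (s + j) = Finset.range (s + j) := by
      ext i
      simp only [Finset.mem_erase, Finset.mem_range]
      omega
    have h1 := IsAccurateConfig.insert_vertex.{u} (S := Finset.range (s + (j + 1)))
      (T := Finset.range s) (ψ := descendantLevels ℓ m d p k) (r := s + j)
      (l := expList (ℓ + m + d) (min p (s + j)) (s + j - min p (s + j)))
      (by simp) (by simp) (by simp) (by
        intro i hi a
        rw [Finset.mem_range] at hi
        simp only [descendantLevels, Finset.mem_Icc]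
        split_ifs <;> omega)
      (by
        refine ⟨d, ?_⟩
        simp only [descendantLevels, Finset.mem_Icc]
        split_ifs <;> omega)
      (by
        rw [length_expList, Finset.card_range]
        omega)
      (by
        rw [herase]
        exact ih (by omega))
    rw [herase, Finset.card_range] at h1
    -- There are ℓ - (s + j) + m + d + 1 levels, one fewer below p; adding the s + j earlier
    -- vertices cancels the dependence on the index.
    have hcard : (descendantLevels ℓ m d p k (s + j)).card + (s + j) =
        if s + j < p then ℓ + m + d else ℓ + m + d + 1 := by
      simp only [descendantLevels, Int.card_Icc]
      split_ifs <;> omega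
    rw [hcard] at h1
    split_ifs at h1 with hp
    · rw [show min p (s + j) = s + j by omega, Nat.sub_self, ← expList_succ_left] at h1
      rw [show min p (s + (j + 1)) = s + j + 1 by omega,
        show s + (j + 1) - (s + j + 1) = 0 by omega]
      exact h1
    · rw [← expList_succ_right] at h1
      rw [show min p (s + (j + 1)) = min p (s + j) by omega,
        show s + (j + 1) - min p (s + j) = s + j - min p (s + j) + 1 by omega]
      exact h1

/-- The coordinate forms on `ℝ^ℓ × ℝ`. -/
def coneCoord (ℓ i : ℕ) : Module.Dual ℝ ((Fin ℓ → ℝ) × ℝ) :=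
  if h : i < ℓ then LinearMap.proj ⟨i, h⟩ ∘ₗ LinearMap.fst ℝ (Fin ℓ → ℝ) ℝ else 0

theorem coneCoord_apply {ℓ : ℕ} (i : Fin ℓ) (v : (Fin ℓ → ℝ) × ℝ) : coneCoord ℓ i v = v.1 i := by
  simp [coneCoord]

theorem indepCoords_coneCoord (ℓ : ℕ) :
    IndepCoords (Finset.range ℓ) (coneCoord ℓ) (LinearMap.snd ℝ (Fin ℓ → ℝ) ℝ) := by
  intro a w
  refine ⟨(fun i => a i, w), rfl, fun i hi => ?_⟩
  exact coneCoord_apply ⟨i, Finset.mem_range.1 hi⟩ _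

/-- The hyperplanes of the cone, from arbitrary equations of the affine hyperplanes. -/
theorem ker_homogenize_mem_cone_iff {K V : Type*} [Field K] [AddCommGroup V] [Module K V]
    {A : AffineArrangement K V} {α : Module.Dual K V} (hα : α ≠ 0) {c : K} {H : Set V}
    (hH : H = {x | α x = c}) (hA : H ∈ A.hyperplanes) :
    LinearMap.ker (homogenize α c) ∈ A.cone.hyperplanes :=
  Or.inr ⟨α, c, hα, hH ▸ hA, rfl⟩

/-- The cone is defined through arbitrary equations of the affine hyperplanes; this allows the
standard equations to be used instead. -/
theorem ker_homogenize_congr {K V : Type*} [Field K] [AddCommGroup V] [Module K V]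
    {α β : Module.Dual K V} (hα : α ≠ 0) (hβ : β ≠ 0) {c d : K}
    (h : {x | α x = c} = {x | β x = d}) :
    LinearMap.ker (homogenize α c) = LinearMap.ker (homogenize β d) := by
  rw [ker_homogenize hα, ker_homogenize hβ, h]

theorem proj_ne_zero {ℓ : ℕ} (i : Fin ℓ) :
    (LinearMap.proj i : Module.Dual ℝ (Fin ℓ → ℝ)) ≠ 0 := by
  intro h
  have := LinearMap.congr_fun h (Pi.single i 1)
  simp at this

theorem proj_sub_proj_ne_zero {ℓ : ℕ} {i j : Fin ℓ} (hij : i ≠ j) :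
    ((LinearMap.proj i : Module.Dual ℝ (Fin ℓ → ℝ)) - LinearMap.proj j) ≠ 0 := by
  intro h
  have := LinearMap.congr_fun h (Pi.single i 1)
  simp [hij] at this

theorem homogenize_braid {ℓ : ℕ} (i j : Fin ℓ) :
    homogenize ((LinearMap.proj i : Module.Dual ℝ (Fin ℓ → ℝ)) - LinearMap.proj j) 0 =
      coneCoord ℓ i - coneCoord ℓ j := by
  refine LinearMap.ext fun v => ?_
  simp [homogenize_apply, coneCoord_apply]

theorem homogenize_shi {ℓ : ℕ} (i j : Fin ℓ) :
    homogenize ((LinearMap.proj i : Module.Dual ℝ (Fin ℓ → ℝ)) - LinearMap.proj j) 1 =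
      coneCoord ℓ i - coneCoord ℓ j - LinearMap.snd ℝ (Fin ℓ → ℝ) ℝ := by
  refine LinearMap.ext fun v => ?_
  simp [homogenize_apply, coneCoord_apply]

theorem homogenize_level {ℓ : ℕ} (i : Fin ℓ) (c : ℤ) :
    homogenize (LinearMap.proj i : Module.Dual ℝ (Fin ℓ → ℝ)) (c : ℝ) =
      coneCoord ℓ i - (c : ℝ) • LinearMap.snd ℝ (Fin ℓ → ℝ) ℝ := by
  refine LinearMap.ext fun v => ?_
  simp [homogenize_apply, coneCoord_apply]

theorem isPresentedBy_cone_shiDescendant {ℓ m d p k s : ℕ} (hk : 1 ≤ k) (hs : s + k = ℓ + 1) :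
    (shiDescendant ℓ m d p k).cone.IsPresentedBy
      (ShiForm (Finset.range ℓ) (Finset.range s) (descendantLevels ℓ m d p k) (coneCoord ℓ)
        (LinearMap.snd ℝ (Fin ℓ → ℝ) ℝ)) := by
  have hne : ∀ {α : Module.Dual ℝ (Fin ℓ → ℝ)} {c : ℝ}, α ≠ 0 → homogenize α c ≠ 0 :=
    fun h => homogenize_ne_zero h _
  intro H
  constructor
  · rintro (rfl | ⟨α, c, hα, hmem, rfl⟩)
    · exact ⟨_, .infinity, (indepCoords_coneCoord ℓ).z_ne_zero, rfl⟩
    · rcases hmem with (⟨i, j, hij, h⟩ | ⟨i, j, hij, hadj, h⟩) | ⟨i, a, ha, h⟩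
      · have hβ := proj_sub_proj_ne_zero hij.ne
        refine ⟨_, .braid i j (by simp) (by simp), ?_, ?_⟩
        · rw [← homogenize_braid]
          exact hne hβ
        · rw [← homogenize_braid]
          exact ker_homogenize_congr hα hβ h
      · have hβ := proj_sub_proj_ne_zero hij
        have hadj' : i < j ∧ ((j : ℤ) + 1) ≤ (ℓ : ℤ) - k + 1 := hadj
        have hij' : (i : ℕ) < j := hadj'.1
        refine ⟨_, .shi i j (Finset.mem_range.2 ?_) (Finset.mem_range.2 ?_) hij', ?_, ?_⟩
        · omega
        · omega
        · rw [← homogenize_shi]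
          exact hne hβ
        · rw [← homogenize_shi]
          exact ker_homogenize_congr hα hβ h
      · have hβ := proj_ne_zero i
        refine ⟨_, .level i a (by simp) (by rwa [← shiWeight_eq]), ?_, ?_⟩
        · rw [← homogenize_level]
          exact hne hβ
        · rw [← homogenize_level]
          exact ker_homogenize_congr hα hβ h
  · rintro ⟨φ, hφ, h0, rfl⟩
    have hbraid : ∀ i j : Fin ℓ, i < j → LinearMap.ker (coneCoord ℓ i - coneCoord ℓ j) ∈
        (shiDescendant ℓ m d p k).cone.hyperplanes := by
      intro i j hij
      rw [← homogenize_braid]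
      exact ker_homogenize_mem_cone_iff (proj_sub_proj_ne_zero hij.ne) rfl
        (Or.inl (Or.inl ⟨i, j, hij, rfl⟩))
    cases hφ with
    | infinity => exact Or.inl rfl
    | braid i j hi hj =>
      rw [Finset.mem_range] at hi hj
      rcases lt_trichotomy i j with hij | rfl | hij
      · exact hbraid ⟨i, hi⟩ ⟨j, hj⟩ hij
      · exact absurd (sub_self _) h0
      · rw [← neg_sub, LinearMap.ker_neg]
        exact hbraid ⟨j, hj⟩ ⟨i, hi⟩ hij
    | shi i j hi hj hij =>
      rw [Finset.mem_range] at hi hj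
      have hi' : i < ℓ := by omega
      have hj' : j < ℓ := by omega
      have hlt : (⟨i, hi'⟩ : Fin ℓ) < ⟨j, hj'⟩ := hij
      have h1 := homogenize_shi (⟨i, hi'⟩ : Fin ℓ) ⟨j, hj'⟩
      simp only at h1
      rw [← h1]
      refine ker_homogenize_mem_cone_iff (proj_sub_proj_ne_zero hlt.ne) rfl
        (Or.inl (Or.inr ⟨_, _, hlt.ne, ⟨hlt, ?_⟩, rfl⟩))
      simp only
      omega
    | level i a hi ha =>
      rw [Finset.mem_range] at hi
      have h1 := homogenize_level (⟨i, hi⟩ : Fin ℓ) a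
      simp only at h1
      rw [← h1]
      refine ker_homogenize_mem_cone_iff (proj_ne_zero _) rfl (Or.inr ⟨⟨i, hi⟩, a, ?_, rfl⟩)
      rwa [shiWeight_eq]

end ShiDescendants

end HypArr

end

theorem mainTheorem7 (d m ℓ k p : ℕ) (hk : 1 ≤ k) (hkℓ : k ≤ ℓ) (hp : p ≤ ℓ) :
    (HypArr.shiDescendant ℓ m d p k).cone.IndFlagAccurate ∧
      ∀ E : Multiset ℕ, (HypArr.shiDescendant ℓ m d p k).cone.HasExponents E ↔
        E = 1 ::ₘ (Multiset.replicate p (ℓ + m + d) +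
          Multiset.replicate (ℓ - p) (ℓ + m + d + 1)) := by
  have hs : (ℓ + 1 - k) + k = ℓ + 1 := by omega
  -- The tournament occupies ℓ + 1 - k vertices, so k - 1 remain to be adjoined. The cone lives in
  -- dimension ℓ + 1, hence without surplus zeros.
  have h1 := HypArr.isAccurateConfig_descendantLevels.{0} (m := m) (d := d) (p := p) hk hs (k - 1)
    (by omega)
  rw [show ℓ + 1 - k + (k - 1) = ℓ by omega, Nat.min_eq_left hp] at h1
  obtain ⟨⟨hind, hexp⟩, hflag⟩ := h1 _ _ _ _ 0 (HypArr.indepCoords_coneCoord ℓ)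
    (HypArr.isPresentedBy_cone_shiDescendant hk hs) (by simp)
  rw [Multiset.replicate_zero, add_zero] at hexp
  have heq : (HypArr.expList (ℓ + m + d) p (ℓ - p) : Multiset ℕ) =
      1 ::ₘ (Multiset.replicate p (ℓ + m + d) + Multiset.replicate (ℓ - p) (ℓ + m + d + 1)) := by
    rw [HypArr.expList, ← Multiset.cons_coe, ← Multiset.coe_add, Multiset.coe_replicate,
      Multiset.coe_replicate]
  refine ⟨(hflag rfl).indFlagAccurate (HypArr.pairwise_expList (by omega) _ _) hind
    hexp.hasExponents, fun E => ⟨fun hE => ?_, ?_⟩⟩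
  · rw [← heq]
    exact hE.eq_of_hasSaitoExponents hexp
  · rintro rfl
    rw [← heq]
    exact hexp.hasExponents
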